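/- Consider $k$ qubits arranged in a line, in which CNOT gates may only act on two adjacent qubits (linear-nearest-neighbor connectivity), and single-qubit gates may act on any qubit. Let $n\ge 6$ and $k>n+1$, and choose any $n$ of the qubits as the set $C$ of controls, any further qubit $t$ as the target and any further qubit $a$ as an ancilla; the remaining $k-n-2$ qubits and all positions are arbitrary. Let $U\in U(2)$, and let $W$ be the multi-controlled gate that applies $U$ to $t$ if all qubits of $C$ are in state $|1\rangle$ and acts as the identity otherwise. Then there is a circuit of gates from $\{R_x(\theta),R_z(\theta),H,T,T^\dagger,\mathrm{CNOT}\}$ on the $k$ qubits that obeys linear-nearest-neighbor connectivity and implements $W$ with $a$ as a clean ancilla, up to a global phase: there is one $z\in\mathbb{C}$ with $|z|=1$ such that the circuit maps $|\psi\rangle$ to $z\,W|\psi\rangle$ for every state $|\psi\rangle$ of the $k$ qubits in which $a$ is in state $|0\rangle$ (so that $a$ is returned in state $|0\rangle$). The circuit uses $11$ gates from $\{R_x,R_z\}$, in addition to no more than - CNOT gates: cost $12k+12n-56$ and depth $10k+4n$, - $T$ gates ($T$ or $T^\dagger$): cost $16n-32$ and depth $4n$, - $H$ gates: cost $8n-8$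 and depth $4n-1$. Here a circuit is a sequence of time slots, each holding gates that act on pairwise disjoint sets of qubits; the cost of a gate type is the number of gates of that type, and its depth is the number of time slots that hold at least one gate of that type. All bounds hold for the same circuit with the same time slots. -/

import Mathlib

open Matrix

noncomputable section

/-- Computational basis states of a register of `k` qubits in a row, indexed by `Fin k`. -/
abbrev QBasis (k : ℕ) : Type := Fin k → Fin 2

/-- Linear operators on the state space of `k` qubits, as matrices in the computational basis:
`V x y` is the amplitude of `|x⟩` in `V |y⟩`. -/
abbrev QOp (k : ℕ) : Type := Matrix (QBasis k) (QBasis k) ℂ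

/-- The operator that applies the `2 × 2` matrix `U` to qubit `t` when every qubit of `C` is in
state `|1⟩`, and acts as the identity otherwise (meant for `t ∉ C`). For `C = ∅` it is `U` acting
on qubit `t`. -/
def controlledOp {k : ℕ} (C : Finset (Fin k)) (t : Fin k) (U : Matrix (Fin 2) (Fin 2) ℂ) :
    QOp k :=
  Matrix.of fun x y =>
    if ∀ j, j ≠ t → x j = y j then
      if ∀ c ∈ C, y c = 1 then U (x t) (y t) else (1 : Matrix (Fin 2) (Fin 2) ℂ) (x t) (y t)
    else 0

/-- Rotation `R_x(θ) = exp(-i θ X / 2)`. -/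
def rxMatrix (θ : ℝ) : Matrix (Fin 2) (Fin 2) ℂ :=
  !![Complex.cos (θ / 2), -Complex.I * Complex.sin (θ / 2);
     -Complex.I * Complex.sin (θ / 2), Complex.cos (θ / 2)]

/-- Rotation `R_z(θ) = exp(-i θ Z / 2)`. -/
def rzMatrix (θ : ℝ) : Matrix (Fin 2) (Fin 2) ℂ :=
  !![Complex.exp (-Complex.I * θ / 2), 0; 0, Complex.exp (Complex.I * θ / 2)]

/-- The Hadamard matrix. -/
def hMatrix : Matrix (Fin 2) (Fin 2) ℂ :=
  (1 / (Real.sqrt 2 : ℂ)) • !![1, 1; 1, -1]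

/-- The phase matrix `P(θ) = diag(1, exp(i θ))`. -/
def phaseMatrix (θ : ℝ) : Matrix (Fin 2) (Fin 2) ℂ :=
  !![1, 0; 0, Complex.exp (Complex.I * θ)]

/-- The Pauli matrix `X`. -/
def xMatrix : Matrix (Fin 2) (Fin 2) ℂ := !![0, 1; 1, 0]

/-- Elementary gates on `k` qubits: `R_x(θ)`, `R_z(θ)`, `H`, `T = P(π/4)` and its inverse on a
qubit, and `CNOT` with a control and a target. -/
inductive QGate (k : ℕ) : Type
  | rx (θ : ℝ) (q : Fin k)
  | rz (θ : ℝ) (q : Fin k)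
  | h (q : Fin k)
  | t (q : Fin k)
  | tdg (q : Fin k)
  | cnot (control target : Fin k)

/-- The four resources that are counted separately. -/
inductive GateKind : Type
  | rot
  | hadamard
  | tgate
  | cnot
  deriving DecidableEq

namespace QGate

variable {k : ℕ}

/-- The kind of a gate: `R_x` and `R_z` are rotations, and both `T` and `T†` count as T gates. -/
def kind : QGate k → GateKind
  | rx _ _ => .rot
  | rz _ _ => .rot
  | h _ => .hadamard
  | t _ => .tgate
  | tdg _ => .tgate
  | cnot _ _ => .cnot

/-- The qubits on which a gate acts. -/
def qubits : QGate k → Finset (Fin k)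
  | rx _ q => {q}
  | rz _ q => {q}
  | h q => {q}
  | t q => {q}
  | tdg q => {q}
  | cnot c q => {c, q}

/-- The operator of a gate. -/
def op : QGate k → QOp k
  | rx θ q => controlledOp ∅ q (rxMatrix θ)
  | rz θ q => controlledOp ∅ q (rzMatrix θ)
  | h q => controlledOp ∅ q hMatrix
  | t q => controlledOp ∅ q (phaseMatrix (Real.pi / 4))
  | tdg q => controlledOp ∅ q (phaseMatrix (-(Real.pi / 4)))
  | cnot c q => controlledOp {c} q xMatrix

/-- Linear-nearest-neighbor connectivity: a `CNOT` may only act on two adjacent qubits. -/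
def IsLNN : QGate k → Prop
  | cnot c q => c.val + 1 = q.val ∨ q.val + 1 = c.val
  | _ => True

end QGate

/-- A circuit on `k` qubits: a list of time slots, the earliest first, each of which holds gates
that are executed in parallel. -/
abbrev QCircuit (k : ℕ) : Type := List (List (QGate k))

namespace QCircuit

variable {k : ℕ}

/-- Gates in the same time slot act on pairwise disjoint sets of qubits. -/
def IsParallel (c : QCircuit k) : Prop :=
  ∀ L ∈ c, L.Pairwise fun g g' => Disjoint g.qubits g'.qubits

/-- Every gate of the circuit respects linear-nearest-neighbor connectivity. -/
def IsLNN (c : QCircuit k) : Prop :=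
  ∀ L ∈ c, ∀ g ∈ L, g.IsLNN

/-- The operator of a list of gates of which the first is applied first. -/
def opOfGates : List (QGate k) → QOp k
  | [] => 1
  | g :: gs => opOfGates gs * g.op

/-- The operator of a circuit. The gates of one time slot commute when the slot is a valid one. -/
def op (c : QCircuit k) : QOp k := opOfGates c.flatten

/-- The cost for a kind of gate: the number of gates of this kind. -/
def cost (c : QCircuit k) (κ : GateKind) : ℕ :=
  (c.flatten.filter fun g => g.kind = κ).length

/-- The depth for a kind of gate: the number of time slots that hold a gate of this kind. -/
def depth (c : QCircuit k) (κ : GateKind) : ℕ :=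
  (c.filter fun L => ∃ g ∈ L, g.kind = κ).length

end QCircuit

/-- `V` implements `W` with a clean ancilla `a`, up to a global phase: there is one unit complex
number `z` such that `V |ψ⟩ = z W |ψ⟩` for each `|ψ⟩` in which qubit `a` is in state `|0⟩`
(by linearity, it suffices that this holds for the basis states `|y⟩` with `y a = 0`). -/
def ImplementsWithCleanAncilla {k : ℕ} (V W : QOp k) (a : Fin k) : Prop :=
  ∃ z : ℂ, ‖z‖ = 1 ∧ ∀ y : QBasis k, y a = 0 → ∀ x : QBasis k, V x y = z * W x y

end

/-!
Write `U = V D V†` with `D = diag(exp(i α), exp(i β))` and `V = R_z(ω) R_x(η)`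
(`exists_rotation_diagonalization`). Four rotations of the target reduce the multi-controlled `U` to
the multi-controlled `D` (`controlledOp_conj`), a diagonal operator.

The diagonal operator is obtained as `M† Δ M`, where `M` permutes the basis states up to phases and
`Δ` is a diagonal operator on three adjacent qubits. The phases of `M` cancel, so that only the map
`y ↦ F y` that it induces on the basis states matters (`conj_diagonal_apply`). It is enough that, if
the ancilla is `0`, two of the three qubits have certain values in `F y` exactly if all controls are
`1` in `y`, and that in this case the third qubit holds the value of the target up to a constant bit.
Then `Δ` is a product of seven `R_z` rotations of parities with eight CNOT gates between them
(`exists_diagonalGates`), and there are `4 + 7` rotations in all.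

The circuit `M` has three parts. First the ancilla is moved next to the first control
(`IsLine.exists_move`); as it is `0`, the qubits that it passes are only shifted by one position.
Then a chain of Toffoli gates up to phases collects the controls: each gate of the chain acts on
three successive qubits `p < q < r` of the ancilla and the controls, and adds the product of (shifted)
values of `q` and `r` to `p`. Once `p` records that `q` and `r` are `1`, these two serve as
conditionally clean ancillas for the remaining controls: their values are known in the only case
that matters (`IsLine.mapsBasis_chain`). A Toffoli gate on distant qubits is done by
CNOT cascades along the line around four `T` gates and two Hadamard gates
(`IsLine.mapsBasis_toffoliAt`); these change the qubits in between, but again only by constants if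
all controls are `1`. Finally the target is moved next to the two qubits that hold the result.

The cost of the two moves depends on the positions of the ancilla and the target. The line can be
read in both directions, and the better of the two choices satisfies the bounds
(`exists_short_direction`).
-/

/-! ### Operators controlled on a set of qubits -/

section Controlled

variable {k : ℕ}

/-- A sum over basis states whose terms vanish unless the state agrees with `y` off `t` is a sum
over the value of qubit `t`. -/
theorem sum_eq_sum_update (t : Fin k) (y : QBasis k) (g : QBasis k → ℂ)
    (hg : ∀ z, ¬ (∀ j, j ≠ t → z j = y j) → g z = 0) :
    ∑ z, g z = ∑ b, g (Function.update y t b) := by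
  rw [← Finset.sum_image (s := Finset.univ) (g := fun b => Function.update y t b) (f := g)
    (fun _ _ _ _ h => Function.update_injective y t h)]
  refine (Finset.sum_subset (Finset.subset_univ _) fun z _ hz => hg z fun h => hz ?_).symm
  refine Finset.mem_image.2 ⟨z t, Finset.mem_univ _, ?_⟩
  funext j
  by_cases hj : j = t
  · subst hj; simp
  · simp [hj, h j hj]

/-- The operator that applies `A` to qubit `t` when every qubit of `C` is in state `|1⟩`, and `B`
otherwise. -/
def controlledPair (C : Finset (Fin k)) (t : Fin k) (A B : Matrix (Fin 2) (Fin 2) ℂ) : QOp k :=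
  Matrix.of fun x y =>
    if ∀ j, j ≠ t → x j = y j then
      if ∀ c ∈ C, y c = 1 then A (x t) (y t) else B (x t) (y t)
    else 0

theorem controlledOp_eq_controlledPair (C : Finset (Fin k)) (t : Fin k)
    (U : Matrix (Fin 2) (Fin 2) ℂ) : controlledOp C t U = controlledPair C t U 1 := rfl

theorem controlledOp_empty_eq_controlledPair (C : Finset (Fin k)) (t : Fin k)
    (U : Matrix (Fin 2) (Fin 2) ℂ) : controlledOp ∅ t U = controlledPair C t U U := by
  ext x y
  simp [controlledOp, controlledPair]

theorem controlledPair_mul {C : Finset (Fin k)} {t : Fin k} (ht : t ∉ C)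
    (A B A' B' : Matrix (Fin 2) (Fin 2) ℂ) :
    controlledPair C t A B * controlledPair C t A' B' = controlledPair C t (A * A') (B * B') := by
  ext x y
  rw [Matrix.mul_apply, sum_eq_sum_update t y]
  · have hC : ∀ b : Fin 2, (∀ c ∈ C, Function.update y t b c = 1) ↔ ∀ c ∈ C, y c = 1 := by
      intro b
      refine forall₂_congr fun c hc => ?_
      rw [Function.update_of_ne (ne_of_mem_of_not_mem hc ht)]
    have hx : ∀ b : Fin 2, (∀ j, j ≠ t → x j = Function.update y t b j) ↔
        ∀ j, j ≠ t → x j = y j := by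
      intro b
      refine forall₂_congr fun j hj => ?_
      rw [Function.update_of_ne hj]
    have hy : ∀ b : Fin 2, ∀ j, j ≠ t → Function.update y t b j = y j :=
      fun b j hj => Function.update_of_ne hj _ _
    simp only [controlledPair, Matrix.of_apply, hC, hx, Function.update_self, if_pos (hy _)]
    by_cases h1 : ∀ j, j ≠ t → x j = y j
    · by_cases h2 : ∀ c ∈ C, y c = 1
      · simp only [if_pos h1, if_pos h2, Matrix.mul_apply]
      · simp only [if_pos h1, if_neg h2, Matrix.mul_apply]
    · simp only [if_neg h1, zero_mul, Finset.sum_const_zero]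
  · intro z hz
    have : controlledPair C t A' B' z y = 0 := by
      simp only [controlledPair, Matrix.of_apply, if_neg hz]
    rw [this, mul_zero]

theorem controlledPair_one (C : Finset (Fin k)) (t : Fin k) :
    controlledPair C t (1 : Matrix (Fin 2) (Fin 2) ℂ) 1 = 1 := by
  ext x y
  simp only [controlledPair, Matrix.of_apply, ite_self]
  by_cases h : x = y
  · subst h; simp
  · rw [Matrix.one_apply_ne h]
    split_ifs with h1
    · refine Matrix.one_apply_ne fun h2 => h (funext fun j => ?_)
      by_cases hj : j = t
      · rw [hj, h2]
      · exact h1 j hj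
    · rfl

theorem controlledOp_mul {C : Finset (Fin k)} {t : Fin k} (ht : t ∉ C)
    (U V : Matrix (Fin 2) (Fin 2) ℂ) :
    controlledOp C t U * controlledOp C t V = controlledOp C t (U * V) := by
  simp only [controlledOp_eq_controlledPair, controlledPair_mul ht, mul_one]

theorem controlledOp_one (C : Finset (Fin k)) (t : Fin k) : controlledOp C t 1 = 1 :=
  controlledPair_one C t

/-- A basis change of the target qubit turns a controlled gate into the controlled conjugate. -/
theorem controlledOp_conj {C : Finset (Fin k)} {t : Fin k} (ht : t ∉ C)
    (V D V' : Matrix (Fin 2) (Fin 2) ℂ) (hV : V * V' = 1) :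
    controlledOp ∅ t V * controlledOp C t D * controlledOp ∅ t V' =
      controlledOp C t (V * D * V') := by
  rw [controlledOp_empty_eq_controlledPair C, controlledOp_empty_eq_controlledPair C,
    controlledOp_eq_controlledPair, controlledPair_mul ht, controlledPair_mul ht, mul_one, hV]
  rfl

end Controlled

/-! ### Inverse gates and circuits -/

section Matrices

theorem rxMatrix_neg_mul (θ : ℝ) : rxMatrix (-θ) * rxMatrix θ = 1 := by
  ext i j
  fin_cases i <;> fin_cases j <;>
    simp [rxMatrix, Matrix.mul_apply, Fin.sum_univ_two, neg_div] <;>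
    ring_nf <;> simp

theorem rzMatrix_neg_mul (θ : ℝ) : rzMatrix (-θ) * rzMatrix θ = 1 := by
  ext i j
  fin_cases i <;> fin_cases j <;>
    simp [rzMatrix, Matrix.mul_apply, Fin.sum_univ_two, neg_div, ← Complex.exp_add]

theorem hMatrix_mul_self : hMatrix * hMatrix = 1 := by
  have h : ((Real.sqrt 2 : ℝ) : ℂ) * (Real.sqrt 2 : ℝ) = 2 := by
    rw [← Complex.ofReal_mul, Real.mul_self_sqrt (by norm_num)]; norm_num
  have h0 : ((Real.sqrt 2 : ℝ) : ℂ) ≠ 0 := by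
    intro h'; rw [h'] at h; norm_num at h
  ext i j
  fin_cases i <;> fin_cases j <;>
    simp [hMatrix, Matrix.mul_apply, Fin.sum_univ_two] <;>
    field_simp <;> linear_combination -h

theorem phaseMatrix_mul (θ η : ℝ) : phaseMatrix θ * phaseMatrix η = phaseMatrix (θ + η) := by
  ext i j
  fin_cases i <;> fin_cases j <;>
    simp [phaseMatrix, Matrix.mul_apply, Fin.sum_univ_two, ← Complex.exp_add, mul_add]

theorem phaseMatrix_zero : phaseMatrix 0 = 1 := by
  ext i j
  fin_cases i <;> fin_cases j <;> simp [phaseMatrix]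

theorem xMatrix_mul_self : xMatrix * xMatrix = 1 := by
  ext i j
  fin_cases i <;> fin_cases j <;> simp [xMatrix, Matrix.mul_apply, Fin.sum_univ_two]

end Matrices

namespace QGate

variable {k : ℕ}

/-- The inverse gate. -/
noncomputable def inv : QGate k → QGate k
  | rx θ q => rx (-θ) q
  | rz θ q => rz (-θ) q
  | h q => h q
  | t q => tdg q
  | tdg q => t q
  | cnot c q => cnot c q

theorem kind_inv (g : QGate k) : g.inv.kind = g.kind := by cases g <;> rfl

theorem qubits_inv (g : QGate k) : g.inv.qubits = g.qubits := by cases g <;> rfl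

theorem isLNN_inv (g : QGate k) : g.inv.IsLNN ↔ g.IsLNN := by cases g <;> exact Iff.rfl

theorem IsLNN.ne {c q : Fin k} (h : (cnot c q).IsLNN) : c ≠ q := by
  rintro rfl
  simp [IsLNN] at h

theorem op_inv_mul {g : QGate k} (hg : g.IsLNN) : g.inv.op * g.op = 1 := by
  cases g with
  | rx θ q => simp only [inv, op, controlledOp_mul (Finset.notMem_empty _), rxMatrix_neg_mul,
      controlledOp_one]
  | rz θ q => simp only [inv, op, controlledOp_mul (Finset.notMem_empty _), rzMatrix_neg_mul,
      controlledOp_one]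
  | h q => simp only [inv, op, controlledOp_mul (Finset.notMem_empty _), hMatrix_mul_self,
      controlledOp_one]
  | t q => simp only [inv, op, controlledOp_mul (Finset.notMem_empty _), phaseMatrix_mul,
      neg_add_cancel, phaseMatrix_zero, controlledOp_one]
  | tdg q => simp only [inv, op, controlledOp_mul (Finset.notMem_empty _), phaseMatrix_mul,
      add_neg_cancel, phaseMatrix_zero, controlledOp_one]
  | cnot c q =>
    have : q ∉ ({c} : Finset (Fin k)) := by
      simpa using (IsLNN.ne hg).symm
    simp only [inv, op, controlledOp_mul this, xMatrix_mul_self, controlledOp_one]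

end QGate

namespace QCircuit

variable {k : ℕ}

theorem opOfGates_append (l l' : List (QGate k)) :
    opOfGates (l ++ l') = opOfGates l' * opOfGates l := by
  induction l with
  | nil => simp [opOfGates]
  | cons g l ih => simp [opOfGates, ih, Matrix.mul_assoc]

theorem opOfGates_singleton (g : QGate k) : opOfGates [g] = g.op := by simp [opOfGates]

theorem opOfGates_inv_mul (l : List (QGate k)) (hl : ∀ g ∈ l, g.IsLNN) :
    opOfGates (l.map QGate.inv).reverse * opOfGates l = 1 := by
  induction l with
  | nil => simp [opOfGates]
  | cons g l ih =>
    have ih := ih fun g' hg' => hl g' (List.mem_cons_of_mem _ hg')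
    rw [List.map_cons, List.reverse_cons, opOfGates_append, opOfGates_singleton]
    calc g.inv.op * opOfGates (l.map QGate.inv).reverse * (opOfGates l * g.op)
        = g.inv.op * (opOfGates (l.map QGate.inv).reverse * opOfGates l) * g.op := by
          simp only [Matrix.mul_assoc]
      _ = 1 := by rw [ih, mul_one, QGate.op_inv_mul (hl g (by simp))]

/-- The circuit that undoes `c`: inverse gates in the reverse order. -/
noncomputable def inv (c : QCircuit k) : QCircuit k :=
  (c.map fun L => (L.map QGate.inv).reverse).reverse

theorem flatten_inv (c : QCircuit k) : (inv c).flatten = (c.flatten.map QGate.inv).reverse := by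
  induction c with
  | nil => rfl
  | cons L c ih =>
    have : inv (L :: c) = inv c ++ [(L.map QGate.inv).reverse] := by simp [inv]
    rw [this, List.flatten_append, ih]
    simp

theorem isLNN_append {c c' : QCircuit k} (h : IsLNN c) (h' : IsLNN c') : IsLNN (c ++ c') := by
  intro L hL
  rcases List.mem_append.1 hL with hL | hL
  exacts [h L hL, h' L hL]

theorem isParallel_append {c c' : QCircuit k} (h : IsParallel c) (h' : IsParallel c') :
    IsParallel (c ++ c') := by
  intro L hL
  rcases List.mem_append.1 hL with hL | hL
  exacts [h L hL, h' L hL]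

theorem isLNN_inv {c : QCircuit k} (h : IsLNN c) : IsLNN (inv c) := by
  intro L hL g hg
  simp only [inv, List.mem_reverse, List.mem_map] at hL
  obtain ⟨L', hL', rfl⟩ := hL
  simp only [List.mem_reverse, List.mem_map] at hg
  obtain ⟨g', hg', rfl⟩ := hg
  exact (QGate.isLNN_inv g').2 (h L' hL' g' hg')

theorem isParallel_inv {c : QCircuit k} (h : IsParallel c) : IsParallel (inv c) := by
  intro L hL
  simp only [inv, List.mem_reverse, List.mem_map] at hL
  obtain ⟨L', hL', rfl⟩ := hL
  rw [List.pairwise_reverse, List.pairwise_map]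
  refine (h L' hL').imp fun hd => ?_
  rw [QGate.qubits_inv, QGate.qubits_inv]
  exact hd.symm

/-! ### Counting gates and time slots -/

theorem cost_append (c c' : QCircuit k) (κ : GateKind) :
    cost (c ++ c') κ = cost c κ + cost c' κ := by
  simp [cost]

theorem depth_append (c c' : QCircuit k) (κ : GateKind) :
    depth (c ++ c') κ = depth c κ + depth c' κ := by
  simp [depth]

theorem cost_cons (L : List (QGate k)) (c : QCircuit k) (κ : GateKind) :
    cost (L :: c) κ = (L.filter fun g => g.kind = κ).length + cost c κ := by
  simp [cost]

theorem cost_inv (c : QCircuit k) (κ : GateKind) : cost (inv c) κ = cost c κ := by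
  simp only [cost, flatten_inv, List.filter_reverse, List.length_reverse, List.filter_map,
    List.length_map]
  congr 2
  funext g
  simp [QGate.kind_inv]

theorem depth_inv (c : QCircuit k) (κ : GateKind) : depth (inv c) κ = depth c κ := by
  simp only [depth, inv, List.filter_reverse, List.length_reverse, List.filter_map,
    List.length_map]
  congr 2
  funext L
  simp [QGate.kind_inv]

theorem depth_le_cost (c : QCircuit k) (κ : GateKind) : depth c κ ≤ cost c κ := by
  induction c with
  | nil => simp [depth, cost]
  | cons L c ih =>
    rw [cost_cons]
    by_cases h : ∃ g ∈ L, g.kind = κ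
    · have h1 : depth (L :: c) κ = depth c κ + 1 := by
        simp only [depth]
        rw [List.filter_cons_of_pos (by simpa using h), List.length_cons]
      have h2 : 0 < (L.filter fun g => g.kind = κ).length := by
        obtain ⟨g, hg, hk⟩ := h
        exact List.length_pos_of_mem (List.mem_filter.2 ⟨hg, by simpa using hk⟩)
      omega
    · have h1 : depth (L :: c) κ = depth c κ := by
        simp only [depth]
        rw [List.filter_cons_of_neg (by simpa using h)]
      omega

theorem depth_le_length (c : QCircuit k) (κ : GateKind) : depth c κ ≤ c.length :=
  List.length_filter_le _ _

/-- The circuit that executes one gate per time slot. -/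
def serial (l : List (QGate k)) : QCircuit k := l.map fun g => [g]

theorem flatten_serial (l : List (QGate k)) : (serial l).flatten = l := by
  induction l with
  | nil => rfl
  | cons g l ih => simpa [serial] using ih

theorem isParallel_serial (l : List (QGate k)) : IsParallel (serial l) := by
  intro L hL
  obtain ⟨g, -, rfl⟩ := List.mem_map.1 hL
  simp

theorem isLNN_serial {l : List (QGate k)} (h : ∀ g ∈ l, g.IsLNN) : IsLNN (serial l) := by
  intro L hL
  obtain ⟨g, hg, rfl⟩ := List.mem_map.1 hL
  simpa using h g hg

theorem cost_serial (l : List (QGate k)) (κ : GateKind) :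
    cost (serial l) κ = (l.filter fun g => g.kind = κ).length := by
  rw [cost, flatten_serial]

end QCircuit

/-! ### Gates that permute the basis states up to phases -/

theorem controlledOp_diagonal_apply {k : ℕ} (C : Finset (Fin k)) (q : Fin k)
    (D : Matrix (Fin 2) (Fin 2) ℂ) (hD : ∀ a b, a ≠ b → D a b = 0) (x y : QBasis k) :
    controlledOp C q D x y =
      if x = y then if ∀ c ∈ C, y c = 1 then D (y q) (y q) else 1 else 0 := by
  by_cases hxy : x = y
  · subst hxy; simp [controlledOp]
  · rw [if_neg hxy]
    simp only [controlledOp, Matrix.of_apply]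
    by_cases h : ∀ j, j ≠ q → x j = y j
    · have hq : x q ≠ y q := fun hq => hxy (funext fun j => by
        by_cases hj : j = q
        · rw [hj, hq]
        · exact h j hj)
      rw [if_pos h, hD _ _ hq, Matrix.one_apply_ne hq, ite_self]
    · rw [if_neg h]

namespace QGate

variable {k : ℕ}

/-- The action on basis states of a gate that permutes them up to phases. The value is irrelevant
for `R_x` and `H`. -/
def act : QGate k → QBasis k → QBasis k
  | cnot c q, y => Function.update y q (y q + y c)
  | _, y => y

/-- The phase with which a gate maps the basis state `y` to `g.act y`. -/
noncomputable def phase : QGate k → QBasis k → ℂ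
  | rz θ q, y => rzMatrix θ (y q) (y q)
  | t q, y => phaseMatrix (Real.pi / 4) (y q) (y q)
  | tdg q, y => phaseMatrix (-(Real.pi / 4)) (y q) (y q)
  | _, _ => 1

/-- The gates that permute the basis states up to phases. -/
def IsMonomial : QGate k → Prop
  | rx _ _ => False
  | h _ => False
  | _ => True

theorem op_apply {g : QGate k} (hm : g.IsMonomial) (hl : g.IsLNN) (x y : QBasis k) :
    g.op x y = if x = g.act y then g.phase y else 0 := by
  cases g with
  | rx θ q => exact hm.elim
  | h q => exact hm.elim
  | rz θ q =>
    rw [op, controlledOp_diagonal_apply]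
    · simp only [Finset.notMem_empty, false_imp_iff, implies_true, if_true]; rfl
    · intro a b hab
      fin_cases a <;> fin_cases b <;> simp_all [rzMatrix]
  | t q =>
    rw [op, controlledOp_diagonal_apply]
    · simp only [Finset.notMem_empty, false_imp_iff, implies_true, if_true]; rfl
    · intro a b hab
      fin_cases a <;> fin_cases b <;> simp_all [phaseMatrix]
  | tdg q =>
    rw [op, controlledOp_diagonal_apply]
    · simp only [Finset.notMem_empty, false_imp_iff, implies_true, if_true]; rfl
    · intro a b hab
      fin_cases a <;> fin_cases b <;> simp_all [phaseMatrix]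
  | cnot c q =>
    have hc : c ≠ q := IsLNN.ne hl
    have hact : (cnot c q).act y = Function.update y q (y q + y c) := rfl
    rw [hact]
    simp only [op, phase, controlledOp, Matrix.of_apply, Finset.mem_singleton, forall_eq]
    by_cases h : ∀ j, j ≠ q → x j = y j
    · rw [if_pos h]
      have : x = Function.update y q (y q + y c) ↔ x q = y q + y c := by
        refine ⟨fun hx => by rw [hx]; simp, fun hx => funext fun j => ?_⟩
        by_cases hj : j = q
        · subst hj; simp [hx]
        · simp [hj, h j hj]
      simp only [this]
      generalize x q = a
      generalize y q = b
      generalize y c = d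
      fin_cases a <;> fin_cases b <;> fin_cases d <;> simp [xMatrix]
    · rw [if_neg h, if_neg]
      rintro rfl
      exact h fun j hj => by simp [hj]

end QGate

section Monomial

variable {k : ℕ}

/-- The action on basis states of a list of gates of which the first is applied first. -/
def actList : List (QGate k) → QBasis k → QBasis k
  | [], y => y
  | g :: l, y => actList l (g.act y)

/-- The phase that a list of gates gives to the basis state `y`. -/
noncomputable def phaseList : List (QGate k) → QBasis k → ℂ
  | [], _ => 1
  | g :: l, y => phaseList l (g.act y) * g.phase y

theorem actList_nil (y : QBasis k) : actList [] y = y := rfl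

theorem actList_cons (g : QGate k) (l : List (QGate k)) (y : QBasis k) :
    actList (g :: l) y = actList l (g.act y) := rfl

theorem actList_append (l l' : List (QGate k)) (y : QBasis k) :
    actList (l ++ l') y = actList l' (actList l y) := by
  induction l generalizing y with
  | nil => rfl
  | cons g l ih => exact ih _

theorem phaseList_append (l l' : List (QGate k)) (y : QBasis k) :
    phaseList (l ++ l') y = phaseList l' (actList l y) * phaseList l y := by
  induction l generalizing y with
  | nil => simp [phaseList, actList]
  | cons g l ih => simp only [List.cons_append, phaseList, actList_cons, ih, mul_assoc]

theorem opOfGates_apply {l : List (QGate k)} (hm : ∀ g ∈ l, g.IsMonomial)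
    (hl : ∀ g ∈ l, g.IsLNN) (x y : QBasis k) :
    QCircuit.opOfGates l x y = if x = actList l y then phaseList l y else 0 := by
  induction l generalizing x y with
  | nil =>
    rw [actList_nil]
    by_cases h : x = y
    · subst h; simp [QCircuit.opOfGates, phaseList]
    · simp [QCircuit.opOfGates, h]
  | cons g l ih =>
    have ih := ih (fun g' h => hm g' (by simp [h])) (fun g' h => hl g' (by simp [h]))
    rw [actList_cons]
    simp only [QCircuit.opOfGates, Matrix.mul_apply, ih, phaseList,
      QGate.op_apply (hm g (by simp)) (hl g (by simp))]
    rw [Finset.sum_eq_single (g.act y)]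
    · rw [if_pos rfl, ite_mul, zero_mul]
    · intro z _ hz; simp [hz]
    · simp

/-- The operator `M` maps every basis state `y` to a multiple of the basis state `F y`. -/
def MapsBasis (M : QOp k) (F : QBasis k → QBasis k) : Prop :=
  ∀ x y, M x y ≠ 0 → x = F y

theorem MapsBasis.mul {M M' : QOp k} {F F' : QBasis k → QBasis k} (h : MapsBasis M F)
    (h' : MapsBasis M' F') : MapsBasis (M' * M) (F' ∘ F) := by
  intro x y hxy
  rw [Matrix.mul_apply] at hxy
  obtain ⟨z, -, hz⟩ := Finset.exists_ne_zero_of_sum_ne_zero hxy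
  rw [h' x z (left_ne_zero_of_mul hz), h z y (right_ne_zero_of_mul hz)]
  rfl

theorem mapsBasis_one : MapsBasis (1 : QOp k) id := by
  intro x y hxy
  by_contra h
  exact hxy (Matrix.one_apply_ne h)

theorem mapsBasis_opOfGates {l : List (QGate k)} (hm : ∀ g ∈ l, g.IsMonomial)
    (hl : ∀ g ∈ l, g.IsLNN) : MapsBasis (QCircuit.opOfGates l) (actList l) := by
  intro x y hxy
  rw [opOfGates_apply hm hl] at hxy
  by_contra h
  exact hxy (if_neg h)

/-- Conjugation of a diagonal operator by an operator that permutes the basis states up to phases: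
the phases cancel, and the result is diagonal again. -/
theorem conj_diagonal_apply {M M' D : QOp k} {F : QBasis k → QBasis k} {d : QBasis k → ℂ}
    (hM : MapsBasis M F) (hM' : M' * M = 1) (hD : ∀ x y, D x y = if x = y then d y else 0)
    (x y : QBasis k) : (M' * D * M) x y = if x = y then d (F y) else 0 := by
  have h : ∀ z, (D * M) z y = d (F y) * M z y := by
    intro z
    simp only [Matrix.mul_apply, hD, ite_mul, zero_mul, Finset.sum_ite_eq, Finset.mem_univ,
      if_true]
    by_cases hz : M z y = 0
    · simp [hz]
    · rw [hM z y hz]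
  calc (M' * D * M) x y = (M' * (D * M)) x y := by rw [Matrix.mul_assoc]
    _ = d (F y) * (M' * M) x y := by
      rw [Matrix.mul_apply, Matrix.mul_apply, Finset.mul_sum]
      exact Finset.sum_congr rfl fun z _ => by rw [h z]; ring
    _ = if x = y then d (F y) else 0 := by
      rw [hM', Matrix.one_apply, mul_ite, mul_one, mul_zero]

/-- The sign `(-1)^b`. -/
def bitSign (b : Fin 2) : ℂ := if b = 1 then -1 else 1

theorem hMatrix_apply (a b : Fin 2) :
    hMatrix a b = 1 / (Real.sqrt 2 : ℂ) * bitSign (a * b) := by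
  fin_cases a <;> fin_cases b <;> simp [hMatrix, bitSign]

theorem bitSign_sum_eq_zero (a c f s : Fin 2) (h : a ≠ c + f) :
    bitSign (a * (0 + s)) * bitSign (f * 0) * bitSign (0 * c) +
      bitSign (a * (1 + s)) * bitSign (f * 1) * bitSign (1 * c) = 0 := by
  have h1 : a = c + f + 1 := by revert a c f; decide
  subst h1
  fin_cases c <;> fin_cases f <;> fin_cases s <;> simp [bitSign]

/-- Between two Hadamard gates on qubit `q`, a phase `(-1)^(f b)` on the value `b` of this qubit
becomes the addition of `f` to its value, even if the operator between them adds a further bit `s`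
to the qubit: `s` only contributes a phase. -/
theorem hadamard_conj_eq_zero {l : List (QGate k)} (hm : ∀ g ∈ l, g.IsMonomial)
    (hl : ∀ g ∈ l, g.IsLNN) (q : Fin k) (y : QBasis k) (f s : Fin 2) (ρ : ℂ)
    (hoff : ∀ b j, j ≠ q → actList l (Function.update y q b) j = actList l y j)
    (hq : ∀ b, actList l (Function.update y q b) q = b + s)
    (hphase : ∀ b, phaseList l (Function.update y q b) = ρ * bitSign (f * b))
    (x : QBasis k) (hx : QCircuit.opOfGates ([QGate.h q] ++ l ++ [QGate.h q]) x y ≠ 0) :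
    x = Function.update (actList l y) q (y q + f) := by
  have hH : ∀ x y : QBasis k, (QGate.h q).op x y =
      if ∀ j, j ≠ q → x j = y j then hMatrix (x q) (y q) else 0 := by
    intro x y; simp [QGate.op, controlledOp]
  have key : QCircuit.opOfGates ([QGate.h q] ++ l ++ [QGate.h q]) x y =
      ∑ b, (QGate.h q).op x (actList l (Function.update y q b)) *
        (phaseList l (Function.update y q b) * hMatrix b (y q)) := by
    rw [QCircuit.opOfGates_append, QCircuit.opOfGates_append, QCircuit.opOfGates_singleton,
      ← Matrix.mul_assoc, Matrix.mul_apply, sum_eq_sum_update q y]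
    · refine Finset.sum_congr rfl fun b _ => ?_
      rw [Matrix.mul_apply, Finset.sum_eq_single (actList l (Function.update y q b)), hH _ y,
        if_pos fun j hj => Function.update_of_ne hj _ _, opOfGates_apply hm hl, if_pos rfl,
        Function.update_self, mul_assoc]
      · intro z _ hz
        rw [opOfGates_apply hm hl, if_neg hz, mul_zero]
      · simp
    · intro z hz
      rw [hH, if_neg hz, mul_zero]
  rw [key] at hx
  simp only [hH, hq, hphase, hMatrix_apply] at hx
  have hagree : ∀ j, j ≠ q → x j = actList l y j := by
    by_contra hcon
    refine hx (Finset.sum_eq_zero fun b _ => ?_)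
    rw [if_neg fun h => hcon fun j hj => by rw [h j hj, hoff b j hj], zero_mul]
  have hval : x q = y q + f := by
    by_contra hcon
    apply hx
    rw [Fin.sum_univ_two, if_pos fun j hj => by rw [hagree j hj, hoff 0 j hj],
      if_pos fun j hj => by rw [hagree j hj, hoff 1 j hj]]
    have hsum := bitSign_sum_eq_zero (x q) (y q) f s hcon
    linear_combination (1 / (Real.sqrt 2 : ℂ)) * ρ * (1 / (Real.sqrt 2 : ℂ)) * hsum
  funext j
  by_cases hj : j = q
  · subst hj; simp [hval]
  · simp [hj, hagree j hj]

end Monomial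

/-! ### Cascades of CNOT gates along a line -/

section Line

variable {k : ℕ}

/-- A numbering of the qubits by `0, …, k - 1` in which consecutive numbers belong to adjacent
qubits: one of the two directions in which the line can be read. -/
structure IsLine (e : ℕ → Fin k) : Prop where
  inj : ∀ i < k, ∀ j < k, e i = e j → i = j
  surj : ∀ q, ∃ i < k, e i = q
  adj : ∀ i, i + 1 < k → (e i).val + 1 = (e (i + 1)).val ∨ (e (i + 1)).val + 1 = (e i).val

variable {e : ℕ → Fin k}

theorem IsLine.update_apply (he : IsLine e) {q i : ℕ} (hq : q < k) (hi : i < k) (y : QBasis k)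
    (b : Fin 2) : Function.update y (e q) b (e i) = if i = q then b else y (e i) := by
  by_cases h : i = q
  · subst h; simp
  · rw [if_neg h, Function.update_of_ne fun h' => h (he.inj i hi q hq h')]

theorem IsLine.cnot_act (he : IsLine e) {q i : ℕ} (c : ℕ) (hq : q < k) (hi : i < k)
    (y : QBasis k) : (QGate.cnot (e c) (e q)).act y (e i) =
      if i = q then y (e q) + y (e c) else y (e i) :=
  he.update_apply hq hi y _

theorem IsLine.isLNN_right (he : IsLine e) {i : ℕ} (hi : i + 1 < k) :
    (QGate.cnot (e i) (e (i + 1))).IsLNN := he.adj i hi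

theorem IsLine.isLNN_left (he : IsLine e) {i : ℕ} (hi : i + 1 < k) :
    (QGate.cnot (e (i + 1)) (e i)).IsLNN := (he.adj i hi).symm

/-- A gate that is a CNOT of adjacent qubits. -/
def QGate.IsNeighborCnot (g : QGate k) : Prop := ∃ c q, g = QGate.cnot c q ∧ g.IsLNN

theorem QGate.IsNeighborCnot.isMonomial {g : QGate k} (h : g.IsNeighborCnot) : g.IsMonomial := by
  obtain ⟨c, q, rfl, -⟩ := h; trivial

theorem QGate.IsNeighborCnot.isLNN {g : QGate k} (h : g.IsNeighborCnot) : g.IsLNN := by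
  obtain ⟨c, q, -, h⟩ := h; exact h

theorem QGate.IsNeighborCnot.kind_eq {g : QGate k} (h : g.IsNeighborCnot) : g.kind = .cnot := by
  obtain ⟨c, q, rfl, -⟩ := h; rfl

theorem IsLine.isNeighborCnot_right (he : IsLine e) {i : ℕ} (hi : i + 1 < k) :
    (QGate.cnot (e i) (e (i + 1))).IsNeighborCnot := ⟨_, _, rfl, he.isLNN_right hi⟩

theorem IsLine.isNeighborCnot_left (he : IsLine e) {i : ℕ} (hi : i + 1 < k) :
    (QGate.cnot (e (i + 1)) (e i)).IsNeighborCnot := ⟨_, _, rfl, he.isLNN_left hi⟩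

theorem phaseList_eq_one {l : List (QGate k)} (hl : ∀ g ∈ l, g.IsNeighborCnot) (y : QBasis k) :
    phaseList l y = 1 := by
  induction l generalizing y with
  | nil => rfl
  | cons g l ih =>
    obtain ⟨c, q, rfl, -⟩ := hl g (by simp)
    rw [phaseList, ih fun g' h => hl g' (by simp [h])]
    simp [QGate.phase]

theorem actList_reverse_actList {l : List (QGate k)} (hl : ∀ g ∈ l, g.IsNeighborCnot)
    (y : QBasis k) : actList l.reverse (actList l y) = y := by
  induction l generalizing y with
  | nil => rfl
  | cons g l ih =>
    rw [List.reverse_cons, actList_append, actList_cons _ l, ih fun g' h => hl g' (by simp [h])]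
    obtain ⟨c, q, rfl, h⟩ := hl g (by simp)
    have hne := QGate.IsLNN.ne h
    have h2 : ∀ a b : Fin 2, a + b + b = a := by decide
    simp only [actList, QGate.act, Function.update_self, Function.update_of_ne hne,
      Function.update_idem, h2, Function.update_eq_self]

/-- CNOT gates that add to each of the `n` qubits after `P` the value of its left neighbor, so that
the value of qubit `P` is carried on to qubit `P + n`. -/
def cascade (e : ℕ → Fin k) (P n : ℕ) : List (QGate k) :=
  (List.range n).map fun i => QGate.cnot (e (P + i)) (e (P + i + 1))

theorem cascade_succ (P n : ℕ) : cascade e P (n + 1) =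
    cascade e P n ++ [QGate.cnot (e (P + n)) (e (P + n + 1))] := by
  simp [cascade, List.range_succ]

theorem IsLine.isNeighborCnot_cascade (he : IsLine e) {P n : ℕ} (h : P + n < k) :
    ∀ g ∈ cascade e P n, g.IsNeighborCnot := by
  intro g hg
  obtain ⟨i, hi, rfl⟩ := List.mem_map.1 hg
  have := List.mem_range.1 hi
  exact he.isNeighborCnot_right (by omega)

theorem length_cascade (P n : ℕ) : (cascade e P n).length = n := by simp [cascade]

theorem IsLine.actList_cascade_of_notMem (he : IsLine e) {P n i : ℕ} (h : P + n < k) (hi : i < k)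
    (hi' : i ≤ P ∨ P + n < i) (y : QBasis k) : actList (cascade e P n) y (e i) = y (e i) := by
  induction n with
  | zero => rfl
  | succ n ih =>
    rw [cascade_succ, actList_append, actList_cons, actList_nil, he.cnot_act _ (by omega) hi,
      if_neg (by omega), ih (by omega) (by omega)]

theorem IsLine.exists_actList_cascade (he : IsLine e) {P n : ℕ} (h : P + n < k) (y : QBasis k) :
    ∃ s, ∀ b, actList (cascade e P n) (Function.update y (e P) b) (e (P + n)) = b + s := by
  induction n with
  | zero => exact ⟨0, fun b => by simp [cascade, actList]⟩
  | succ n ih =>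
    obtain ⟨s, hs⟩ := ih (by omega)
    refine ⟨s + y (e (P + n + 1)), fun b => ?_⟩
    rw [cascade_succ, actList_append, actList_cons, actList_nil,
      he.cnot_act _ (by omega) (by omega), if_pos (by omega), hs,
      he.actList_cascade_of_notMem (by omega) (by omega) (by omega),
      he.update_apply (by omega) (by omega), if_neg (by omega)]
    abel

theorem IsLine.actList_cascade_reverse (he : IsLine e) {P n i : ℕ} (h : P + n < k) (hi : i < k)
    (y : QBasis k) : actList (cascade e P n).reverse y (e i) =
      if P < i ∧ i ≤ P + n then y (e i) + y (e (i - 1)) else y (e i) := by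
  induction n generalizing y with
  | zero => rw [if_neg (by omega)]; rfl
  | succ n ih =>
    rw [cascade_succ, List.reverse_append, List.reverse_singleton, List.singleton_append,
      actList_cons, ih (by omega)]
    rw [he.cnot_act _ (by omega) hi]
    by_cases h1 : i = P + n + 1
    · subst h1
      rw [if_neg (by omega), if_pos rfl, if_pos (by omega)]
      congr 2
    · rw [if_neg h1]
      by_cases h2 : P < i ∧ i ≤ P + n
      · rw [if_pos h2, if_pos (by omega), he.cnot_act _ (by omega) (by omega), if_neg (by omega)]
      · rw [if_neg h2, if_neg (by omega)]

theorem add_add_add_cancel_two : ∀ a b v : Fin 2, a + b + (b + v) = a + v := by decide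

/-- CNOT gates that add to each of the `m` qubits from `U` on the value of its right neighbor. -/
def pull (e : ℕ → Fin k) (U m : ℕ) : List (QGate k) :=
  (List.range m).map fun i => QGate.cnot (e (U + i + 1)) (e (U + i))

theorem pull_succ (U m : ℕ) : pull e U (m + 1) =
    pull e U m ++ [QGate.cnot (e (U + m + 1)) (e (U + m))] := by
  simp [pull, List.range_succ]

theorem length_pull (U m : ℕ) : (pull e U m).length = m := by simp [pull]

theorem IsLine.isNeighborCnot_pull (he : IsLine e) {U m : ℕ} (h : U + m < k) :
    ∀ g ∈ pull e U m, g.IsNeighborCnot := by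
  intro g hg
  obtain ⟨i, hi, rfl⟩ := List.mem_map.1 hg
  have := List.mem_range.1 hi
  exact he.isNeighborCnot_left (by omega)

theorem IsLine.actList_pull (he : IsLine e) {U m i : ℕ} (h : U + m < k) (hi : i < k)
    (y : QBasis k) : actList (pull e U m) y (e i) =
      if U ≤ i ∧ i < U + m then y (e i) + y (e (i + 1)) else y (e i) := by
  induction m generalizing i with
  | zero => rw [if_neg (by omega)]; rfl
  | succ m ih =>
    rw [pull_succ, actList_append, actList_cons, actList_nil, he.cnot_act _ (by omega) hi]
    by_cases h1 : i = U + m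
    · subst h1
      rw [if_pos rfl, if_pos (by omega), ih (by omega) (by omega), ih (by omega) (by omega),
        if_neg (by omega), if_neg (by omega)]
    · rw [if_neg h1, ih (by omega) hi]
      by_cases h2 : U ≤ i ∧ i < U + m
      · rw [if_pos h2, if_pos (by omega)]
      · rw [if_neg h2, if_neg (by omega)]

theorem IsLine.actList_pull_reverse (he : IsLine e) {U m i : ℕ} (h : U + m < k) (hi : i < k)
    (y z : QBasis k) (v : Fin 2) (hz : ∀ j, U ≤ j → j < U + m → z (e j) = y (e j) + y (e (j + 1)))
    (hv : z (e (U + m)) = y (e (U + m)) + v) : actList (pull e U m).reverse z (e i) =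
      if U ≤ i ∧ i < U + m then y (e i) + v else z (e i) := by
  induction m generalizing z with
  | zero => rw [if_neg (by omega)]; rfl
  | succ m ih =>
    rw [pull_succ, List.reverse_append, List.reverse_singleton, List.singleton_append,
      actList_cons, ih (by omega)]
    · rw [he.cnot_act _ (by omega) hi]
      by_cases h1 : i = U + m
      · subst h1
        rw [if_neg (by omega), if_pos rfl, if_pos (by omega), hz _ (by omega) (by omega)]
        rw [show U + m + 1 = U + (m + 1) by omega, hv]
        exact add_add_add_cancel_two _ _ _
      · rw [if_neg h1]
        by_cases h2 : U ≤ i ∧ i < U + m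
        · rw [if_pos h2, if_pos (by omega)]
        · rw [if_neg h2, if_neg (by omega)]
    · intro j h1 h2
      rw [he.cnot_act _ (by omega) (by omega), if_neg (by omega), hz _ (by omega) (by omega)]
    · rw [he.cnot_act _ (by omega) (by omega), if_pos rfl, hz _ (by omega) (by omega)]
      rw [show U + m + 1 = U + (m + 1) by omega, hv]
      exact add_add_add_cancel_two _ _ _

/-- CNOT gates that add the value of qubit `U + m + 1` to each of the qubits `U, …, U + m`. -/
def fanOut (e : ℕ → Fin k) (U m : ℕ) : List (QGate k) :=
  pull e U (m + 1) ++ (pull e U m).reverse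

theorem IsLine.isNeighborCnot_fanOut (he : IsLine e) {U m : ℕ} (h : U + m + 1 < k) :
    ∀ g ∈ fanOut e U m, g.IsNeighborCnot := by
  intro g hg
  rcases List.mem_append.1 hg with hg | hg
  · exact he.isNeighborCnot_pull (by omega) g hg
  · exact he.isNeighborCnot_pull (by omega) g (List.mem_reverse.1 hg)

theorem length_fanOut (U m : ℕ) : (fanOut e U m).length = 2 * m + 1 := by
  simp [fanOut, length_pull]; omega

theorem IsLine.actList_fanOut (he : IsLine e) {U m i : ℕ} (h : U + m + 1 < k) (hi : i < k)
    (y : QBasis k) : actList (fanOut e U m) y (e i) =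
      if U ≤ i ∧ i ≤ U + m then y (e i) + y (e (U + m + 1)) else y (e i) := by
  rw [fanOut, actList_append, he.actList_pull_reverse (by omega) hi y _ (y (e (U + m + 1)))]
  · by_cases h1 : U ≤ i ∧ i < U + m
    · rw [if_pos h1, if_pos (by omega)]
    · rw [if_neg h1, he.actList_pull (by omega) hi]
      by_cases h2 : i = U + m
      · subst h2
        rw [if_pos (by omega), if_pos (by omega)]
      · rw [if_neg (by omega), if_neg (by omega)]
  · intro j h1 h2
    rw [he.actList_pull (by omega) (by omega), if_pos (by omega)]
  · rw [he.actList_pull (by omega) (by omega), if_pos (by omega)]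

end Line

/-! ### A Toffoli gate up to phases -/

section Toffoli

variable {k : ℕ} {e : ℕ → Fin k}

/-- `T` for `s = 0` and `T†` for `s = 1`. -/
def signedT (s : Fin 2) (q : Fin k) : QGate k := if s = 0 then QGate.t q else QGate.tdg q

/-- The phase that `signedT s` gives to the value `b` of its qubit. -/
noncomputable def tPhase (s b : Fin 2) : ℂ :=
  phaseMatrix (if s = 0 then Real.pi / 4 else -(Real.pi / 4)) b b

theorem signedT_act (s : Fin 2) (q : Fin k) (y : QBasis k) : (signedT s q).act y = y := by
  unfold signedT; split_ifs <;> rfl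

theorem signedT_phase (s : Fin 2) (q : Fin k) (y : QBasis k) :
    (signedT s q).phase y = tPhase s (y q) := by
  unfold signedT tPhase; split_ifs <;> rfl

theorem signedT_kind (s : Fin 2) (q : Fin k) : (signedT s q).kind = .tgate := by
  unfold signedT; split_ifs <;> rfl

theorem signedT_qubits (s : Fin 2) (q : Fin k) : (signedT s q).qubits = {q} := by
  unfold signedT; split_ifs <;> rfl

theorem signedT_isLNN (s : Fin 2) (q : Fin k) : (signedT s q).IsLNN := by
  unfold signedT; split_ifs <;> trivial

theorem signedT_isMonomial (s : Fin 2) (q : Fin k) : (signedT s q).IsMonomial := by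
  unfold signedT; split_ifs <;> trivial

/-- Four `T` gates on the parities `b + s`, `b + s + u`, `b + s + v` and `b + s + u + v` give the
sign `(-1)^b` if `u = pu` and `v = pv`, and no phase that depends on `b` otherwise. -/
theorem exists_tPhase_prod (pu pv u v s : Fin 2) : ∃ ρ : ℂ, ∀ b,
    tPhase (pu + pv) (b + s + u + v) * tPhase pv (b + s + v) *
      (tPhase pu (b + s + u) * tPhase 0 (b + s)) =
      ρ * bitSign ((if u = pu ∧ v = pv then 1 else 0) * b) := by
  obtain ⟨ω, hω⟩ : ∃ ω : ℂ, ω = Complex.exp (Complex.I * (Real.pi / 4 : ℝ)) := ⟨_, rfl⟩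
  have h4 : ω ^ 4 = -1 := by
    rw [hω, ← Complex.exp_nat_mul, ← Complex.exp_pi_mul_I]
    congr 1; push_cast; ring
  have h0 : ∀ s, tPhase s 0 = 1 := fun s => by simp [tPhase, phaseMatrix]
  have h1 : tPhase 0 1 = ω := by simp [tPhase, phaseMatrix, hω]
  have h2 : tPhase 1 1 = -ω ^ 3 := by
    have h3 : ω * tPhase 1 1 = 1 := by
      simp [tPhase, phaseMatrix, hω, ← Complex.exp_add]
    linear_combination tPhase 1 1 * h4 - ω ^ 3 * h3
  refine ⟨tPhase (pu + pv) (0 + s + u + v) * tPhase pv (0 + s + v) *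
      (tPhase pu (0 + s + u) * tPhase 0 (0 + s)), fun b => ?_⟩
  fin_cases b
  · simp [bitSign]
  · fin_cases pu <;> fin_cases pv <;> fin_cases u <;> fin_cases v <;> fin_cases s <;>
      simp [bitSign, h0, h1, h2] <;> grind

end Toffoli

section Toffoli

variable {k : ℕ} {e : ℕ → Fin k}

/-- The CNOT gates of `toffoli` before the first pair of `T` gates: the value of the target `P`,
with those of the idle qubits `P + 1, …, P + n`, is carried to the first control `P + n + 1`. -/
def toffoliPre (e : ℕ → Fin k) (P n : ℕ) : List (QGate k) :=
  cascade e P n ++ [QGate.cnot (e (P + n)) (e (P + n + 1))]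

/-- The CNOT gates of `toffoli` between its two pairs of `T` gates: they add the value of the second
control `P + n + m + 2` to both qubits on which the `T` gates act. -/
def toffoliMid (e : ℕ → Fin k) (P n m : ℕ) : List (QGate k) :=
  QGate.cnot (e (P + n + 1)) (e (P + n)) :: fanOut e (P + n + 1) m ++
    [QGate.cnot (e (P + n + 1)) (e (P + n))]

/-- The CNOT gates of `toffoli` after its second pair of `T` gates. -/
def toffoliPost (e : ℕ → Fin k) (P n : ℕ) : List (QGate k) :=
  QGate.cnot (e (P + n)) (e (P + n + 1)) :: (cascade e P n).reverse

/-- A pair of parallel `T` gates of `toffoli`. -/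
def toffoliSlot (e : ℕ → Fin k) (P n : ℕ) (s s' : Fin 2) : List (QGate k) :=
  [signedT s (e (P + n)), signedT s' (e (P + n + 1))]

/-- The Toffoli gate, up to phases, that flips the target `P` when its first control `P + n + 1` has
the value `pu` and its second control `P + n + m + 2` has the value `pv`. The second control may be
added to idle qubits between the three. -/
def toffoli (e : ℕ → Fin k) (P n m : ℕ) (pu pv : Fin 2) : QCircuit k :=
  QCircuit.serial (QGate.h (e P) :: toffoliPre e P n) ++ [toffoliSlot e P n 0 pu] ++
    QCircuit.serial (toffoliMid e P n m) ++ [toffoliSlot e P n pv (pu + pv)] ++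
    QCircuit.serial (toffoliPost e P n ++ [QGate.h (e P)])

/-- The gates of `toffoli` between its two Hadamard gates. -/
def toffoliCore (e : ℕ → Fin k) (P n m : ℕ) (pu pv : Fin 2) : List (QGate k) :=
  toffoliPre e P n ++ (toffoliSlot e P n 0 pu ++ (toffoliMid e P n m ++
    (toffoliSlot e P n pv (pu + pv) ++ toffoliPost e P n)))

theorem flatten_toffoli (P n m : ℕ) (pu pv : Fin 2) : (toffoli e P n m pu pv).flatten =
    [QGate.h (e P)] ++ toffoliCore e P n m pu pv ++ [QGate.h (e P)] := by
  simp [toffoli, toffoliCore, QCircuit.flatten_serial]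

theorem IsLine.isNeighborCnot_toffoliPre (he : IsLine e) {P n : ℕ} (h : P + n + 1 < k) :
    ∀ g ∈ toffoliPre e P n, g.IsNeighborCnot := by
  intro g hg
  rcases List.mem_append.1 hg with hg | hg
  · exact he.isNeighborCnot_cascade (by omega) g hg
  · rw [List.mem_singleton.1 hg]
    exact he.isNeighborCnot_right h

theorem IsLine.isNeighborCnot_toffoliMid (he : IsLine e) {P n m : ℕ} (h : P + n + m + 2 < k) :
    ∀ g ∈ toffoliMid e P n m, g.IsNeighborCnot := by
  intro g hg
  have h1 := he.isNeighborCnot_left (i := P + n) (by omega)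
  rcases List.mem_append.1 hg with hg | hg
  · rcases List.mem_cons.1 hg with rfl | hg
    · exact h1
    · exact he.isNeighborCnot_fanOut (by omega) g hg
  · rw [List.mem_singleton.1 hg]
    exact h1

theorem IsLine.isNeighborCnot_toffoliPost (he : IsLine e) {P n : ℕ} (h : P + n + 1 < k) :
    ∀ g ∈ toffoliPost e P n, g.IsNeighborCnot := by
  intro g hg
  rcases List.mem_cons.1 hg with rfl | hg
  · exact he.isNeighborCnot_right h
  · exact he.isNeighborCnot_cascade (by omega) g (List.mem_reverse.1 hg)

theorem actList_toffoliSlot (P n : ℕ) (s s' : Fin 2) (y : QBasis k) :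
    actList (toffoliSlot e P n s s') y = y := by
  simp [toffoliSlot, actList, signedT_act]

theorem phaseList_toffoliSlot (P n : ℕ) (s s' : Fin 2) (y : QBasis k) :
    phaseList (toffoliSlot e P n s s') y =
      tPhase s' (y (e (P + n + 1))) * tPhase s (y (e (P + n))) := by
  simp [toffoliSlot, phaseList, signedT_act, signedT_phase]

theorem IsLine.actList_toffoliPre (he : IsLine e) {P n i : ℕ} (h : P + n + 1 < k) (hi : i < k)
    (y : QBasis k) : actList (toffoliPre e P n) y (e i) =
      if i = P + n + 1 then y (e (P + n + 1)) + actList (cascade e P n) y (e (P + n))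
      else actList (cascade e P n) y (e i) := by
  rw [toffoliPre, actList_append, actList_cons, actList_nil, he.cnot_act _ h hi,
    he.actList_cascade_of_notMem (i := P + n + 1) (by omega) (by omega) (by omega)]

theorem IsLine.actList_toffoliMid (he : IsLine e) {P n m i : ℕ} (h : P + n + m + 2 < k)
    (hi : i < k) (z : QBasis k) : actList (toffoliMid e P n m) z (e i) =
      if P + n ≤ i ∧ i ≤ P + n + m + 1 then z (e i) + z (e (P + n + m + 2)) else z (e i) := by
  have h1 : ∀ s : QBasis k, ∀ j < k, actList (fanOut e (P + n + 1) m) s (e j) =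
      if P + n + 1 ≤ j ∧ j ≤ P + n + m + 1 then s (e j) + s (e (P + n + m + 2)) else s (e j) := by
    intro s j hj
    rw [he.actList_fanOut (by omega) hj, show P + n + 1 + m + 1 = P + n + m + 2 by omega,
      show P + n + 1 + m = P + n + m + 1 by omega]
  have h0 : ∀ j < k, j ≠ P + n →
      (QGate.cnot (e (P + n + 1)) (e (P + n))).act z (e j) = z (e j) := fun j hj hj' => by
    rw [he.cnot_act _ (by omega) hj, if_neg hj']
  rw [toffoliMid, actList_append, actList_cons _ (fanOut _ _ _), actList_cons, actList_nil,
    he.cnot_act _ (by omega) hi]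
  by_cases hb : i = P + n
  · subst hb
    rw [if_pos rfl, h1 _ _ hi, if_neg (by omega), h1 _ (P + n + 1) (by omega), if_pos (by omega),
      h0 _ h (by omega), h0 (P + n + 1) (by omega) (by omega), he.cnot_act _ hi hi, if_pos rfl,
      if_pos (by omega)]
    exact add_add_add_cancel_two _ _ _
  · rw [if_neg hb, h1 _ _ hi, h0 _ hi hb, h0 _ h (by omega)]
    by_cases h2 : P + n + 1 ≤ i ∧ i ≤ P + n + m + 1
    · rw [if_pos h2, if_pos (by omega)]
    · rw [if_neg h2, if_neg (by omega)]

theorem IsLine.actList_toffoliCore (he : IsLine e) {P n m i : ℕ} (h : P + n + m + 2 < k)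
    (hi : i < k) (pu pv : Fin 2) (y : QBasis k) :
    actList (toffoliCore e P n m pu pv) y (e i) =
      if P + n ≤ i ∧ i ≤ P + n + m + 1 ∧ i ≠ P + n + 1 then y (e i) + y (e (P + n + m + 2))
      else y (e i) := by
  simp only [toffoliCore, actList_append, actList_toffoliSlot]
  rw [toffoliPost, actList_cons, he.actList_cascade_reverse (by omega) hi]
  obtain ⟨K, hK⟩ : ∃ K, K = actList (cascade e P n) y := ⟨_, rfl⟩
  have hKy : ∀ j < k, j ≤ P ∨ P + n < j → K (e j) = y (e j) := fun j hj hj' => by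
    rw [hK, he.actList_cascade_of_notMem (by omega) hj hj' y]
  -- The value of qubit `j` just before the final cascade.
  have hw : ∀ j < k, (QGate.cnot (e (P + n)) (e (P + n + 1))).act
      (actList (toffoliMid e P n m) (actList (toffoliPre e P n) y)) (e j) =
      if P + n ≤ j ∧ j ≤ P + n + m + 1 ∧ j ≠ P + n + 1 then K (e j) + y (e (P + n + m + 2))
      else K (e j) := by
    intro j hj
    have hV : actList (toffoliPre e P n) y (e (P + n + m + 2)) = y (e (P + n + m + 2)) := by
      rw [he.actList_toffoliPre (by omega) (by omega), if_neg (by omega), ← hK,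
        hKy _ (by omega) (by omega)]
    rw [he.cnot_act _ (by omega) hj]
    by_cases hj1 : j = P + n + 1
    · subst hj1
      rw [if_pos rfl, if_neg (by omega), he.actList_toffoliMid h (by omega), if_pos (by omega),
        he.actList_toffoliMid h (by omega), if_pos (by omega), hV,
        he.actList_toffoliPre (by omega) (by omega), if_pos rfl,
        he.actList_toffoliPre (by omega) (by omega), if_neg (by omega),
        ← hK, hKy (P + n + 1) (by omega) (by omega)]
      have hc : ∀ a b c : Fin 2, a + b + c + (b + c) = a := by decide
      exact hc _ _ _
    · rw [if_neg hj1, he.actList_toffoliMid h hj, hV, he.actList_toffoliPre (by omega) hj,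
        if_neg hj1, ← hK]
      by_cases h2 : P + n ≤ j ∧ j ≤ P + n + m + 1
      · rw [if_pos h2, if_pos ⟨h2.1, h2.2, hj1⟩]
      · rw [if_neg h2, if_neg fun h3 => h2 ⟨h3.1, h3.2.1⟩]
  by_cases h1 : P < i ∧ i ≤ P + n
  · have hy : y (e i) = K (e i) + K (e (i - 1)) := by
      have := he.actList_cascade_reverse (P := P) (n := n) (by omega) hi K
      rw [if_pos h1] at this
      rw [← this, hK, actList_reverse_actList (he.isNeighborCnot_cascade (by omega))]
    rw [if_pos h1, hw _ hi, hw _ (by omega), if_neg (c := P + n ≤ i - 1 ∧ _) (by omega), hy]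
    by_cases h2 : i = P + n
    · rw [if_pos (by omega), if_pos (by omega)]; abel
    · rw [if_neg (by omega), if_neg (by omega)]
  · rw [if_neg h1, hw _ hi, hKy i hi (by omega)]

theorem IsLine.phaseList_toffoliCore (he : IsLine e) {P n m : ℕ} (h : P + n + m + 2 < k)
    (pu pv : Fin 2) (y : QBasis k) : phaseList (toffoliCore e P n m pu pv) y =
      tPhase (pu + pv) (actList (cascade e P n) y (e (P + n)) + y (e (P + n + 1)) +
          y (e (P + n + m + 2))) *
        tPhase pv (actList (cascade e P n) y (e (P + n)) + y (e (P + n + m + 2))) *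
      (tPhase pu (actList (cascade e P n) y (e (P + n)) + y (e (P + n + 1))) *
        tPhase 0 (actList (cascade e P n) y (e (P + n)))) := by
  simp only [toffoliCore, phaseList_append, actList_toffoliSlot, phaseList_toffoliSlot,
    phaseList_eq_one (he.isNeighborCnot_toffoliPre (P := P) (n := n) (by omega)),
    phaseList_eq_one (he.isNeighborCnot_toffoliPost (P := P) (n := n) (by omega)),
    phaseList_eq_one (he.isNeighborCnot_toffoliMid h), one_mul, mul_one]
  have hV : actList (toffoliPre e P n) y (e (P + n + m + 2)) = y (e (P + n + m + 2)) := by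
    rw [he.actList_toffoliPre (by omega) (by omega), if_neg (by omega),
      he.actList_cascade_of_notMem (by omega) (by omega) (by omega)]
  rw [he.actList_toffoliMid h (by omega), if_pos (by omega), hV,
    he.actList_toffoliMid h (by omega), if_pos (by omega), hV,
    he.actList_toffoliPre (by omega) (by omega), if_pos rfl,
    he.actList_toffoliPre (by omega) (by omega), if_neg (by omega),
    add_comm (y (e (P + n + 1)))]

theorem IsLine.isMonomial_toffoliCore (he : IsLine e) {P n m : ℕ} (h : P + n + m + 2 < k)
    (pu pv : Fin 2) : ∀ g ∈ toffoliCore e P n m pu pv, g.IsMonomial ∧ g.IsLNN := by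
  intro g hg
  simp only [toffoliCore, List.mem_append, toffoliSlot, List.mem_cons, List.not_mem_nil,
    or_false] at hg
  rcases hg with hg | (rfl | rfl) | hg | (rfl | rfl) | hg
  · have := he.isNeighborCnot_toffoliPre (by omega) g hg
    exact ⟨this.isMonomial, this.isLNN⟩
  · exact ⟨signedT_isMonomial _ _, signedT_isLNN _ _⟩
  · exact ⟨signedT_isMonomial _ _, signedT_isLNN _ _⟩
  · have := he.isNeighborCnot_toffoliMid h g hg
    exact ⟨this.isMonomial, this.isLNN⟩
  · exact ⟨signedT_isMonomial _ _, signedT_isLNN _ _⟩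
  · exact ⟨signedT_isMonomial _ _, signedT_isLNN _ _⟩
  · have := he.isNeighborCnot_toffoliPost (by omega) g hg
    exact ⟨this.isMonomial, this.isLNN⟩

/-- The target value `b` enters the four parities only through `b + s`, where `s` comes from the
cascade over the idle qubits. So the phase is a sign that depends on `b`, up to a factor that does
not, and the Hadamard gates turn it into the addition of the product of the controls to `P`. -/
theorem IsLine.mapsBasis_toffoli (he : IsLine e) {P n m : ℕ} (h : P + n + m + 2 < k)
    (pu pv : Fin 2) : ∃ F : QBasis k → QBasis k,
      MapsBasis (QCircuit.op (toffoli e P n m pu pv)) F ∧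
      ∀ y, ∀ i < k, F y (e i) =
        if i = P then
          y (e P) + (if y (e (P + n + 1)) = pu ∧ y (e (P + n + m + 2)) = pv then 1 else 0)
        else if P + n ≤ i ∧ i ≤ P + n + m + 1 ∧ i ≠ P + n + 1 then
          y (e i) + y (e (P + n + m + 2))
        else y (e i) := by
  refine ⟨fun y => Function.update (actList (toffoliCore e P n m pu pv) y) (e P)
    (y (e P) + if y (e (P + n + 1)) = pu ∧ y (e (P + n + m + 2)) = pv then 1 else 0), ?_, ?_⟩
  · intro x y hxy
    rw [QCircuit.op, flatten_toffoli] at hxy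
    obtain ⟨s, hs⟩ := he.exists_actList_cascade (P := P) (n := n) (by omega) y
    obtain ⟨ρ, hρ⟩ := exists_tPhase_prod pu pv (y (e (P + n + 1))) (y (e (P + n + m + 2))) s
    have hm := he.isMonomial_toffoliCore h pu pv
    have hupd : ∀ b i, i < k → i ≠ P → Function.update y (e P) b (e i) = y (e i) :=
      fun b i hi hiP => by rw [he.update_apply (by omega) hi, if_neg hiP]
    refine hadamard_conj_eq_zero (fun g hg => (hm g hg).1) (fun g hg => (hm g hg).2) (e P) y _
      (if n = 0 then y (e (P + n + m + 2)) else 0) ρ ?_ ?_ ?_ x hxy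
    · intro b j hj
      obtain ⟨i, hi, rfl⟩ := he.surj j
      have hiP : i ≠ P := fun h' => hj (h' ▸ rfl)
      rw [he.actList_toffoliCore h hi, he.actList_toffoliCore h hi,
        hupd b i hi hiP, hupd b _ h (by omega)]
    · intro b
      rw [he.actList_toffoliCore h (by omega), hupd b _ h (by omega), Function.update_self]
      by_cases hn : n = 0
      · rw [if_pos (by omega), if_pos hn]
      · rw [if_neg (by omega), if_neg hn, add_zero]
    · intro b
      rw [he.phaseList_toffoliCore h, hs, hupd b _ h (by omega),
        hupd b (P + n + 1) (by omega) (by omega)]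
      exact hρ b
  · intro y i hi
    simp only
    rw [he.update_apply (by omega) hi, he.actList_toffoliCore h hi]

theorem IsLine.isLNN_toffoli (he : IsLine e) {P n m : ℕ} (h : P + n + m + 2 < k)
    (pu pv : Fin 2) : QCircuit.IsLNN (toffoli e P n m pu pv) := by
  intro L hL g hg
  have : g ∈ (toffoli e P n m pu pv).flatten := List.mem_flatten.2 ⟨L, hL, hg⟩
  rw [flatten_toffoli] at this
  simp only [List.mem_append, List.mem_singleton] at this
  rcases this with (rfl | hg) | rfl
  · trivial
  · exact (he.isMonomial_toffoliCore h pu pv g hg).2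
  · trivial

theorem IsLine.isParallel_toffoliSlot (he : IsLine e) {P n : ℕ} (h : P + n + 1 < k)
    (s s' : Fin 2) : QCircuit.IsParallel [toffoliSlot e P n s s'] := by
  intro L hL
  rw [List.mem_singleton.1 hL]
  simp only [toffoliSlot, List.pairwise_cons, List.mem_singleton, forall_eq, List.not_mem_nil,
    false_imp_iff, implies_true, List.Pairwise.nil, and_true, signedT_qubits,
    Finset.disjoint_singleton]
  intro h'
  have := he.inj _ (by omega) _ h h'
  omega

theorem IsLine.isParallel_toffoli (he : IsLine e) {P n : ℕ} (h : P + n + 1 < k) (m : ℕ)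
    (pu pv : Fin 2) : QCircuit.IsParallel (toffoli e P n m pu pv) :=
  QCircuit.isParallel_append (QCircuit.isParallel_append (QCircuit.isParallel_append
    (QCircuit.isParallel_append (QCircuit.isParallel_serial _) (he.isParallel_toffoliSlot h _ _))
    (QCircuit.isParallel_serial _)) (he.isParallel_toffoliSlot h _ _))
    (QCircuit.isParallel_serial _)

theorem length_filter_kind_eq_cnot {l : List (QGate k)} (hl : ∀ g ∈ l, g.IsNeighborCnot)
    (κ : GateKind) : (l.filter fun g => g.kind = κ).length = if κ = .cnot then l.length else 0 := by
  split_ifs with h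
  · rw [List.filter_eq_self.2]
    intro g hg
    simpa [h] using (hl g hg).kind_eq
  · rw [List.filter_eq_nil_iff.2, List.length_nil]
    intro g hg
    simpa [(hl g hg).kind_eq] using fun h' => h h'.symm

theorem IsLine.cost_toffoli (he : IsLine e) {P n m : ℕ} (h : P + n + m + 2 < k) (pu pv : Fin 2) :
    QCircuit.cost (toffoli e P n m pu pv) .rot = 0 ∧
    QCircuit.cost (toffoli e P n m pu pv) .cnot = 2 * n + 2 * m + 5 ∧
    QCircuit.cost (toffoli e P n m pu pv) .tgate = 4 ∧
    QCircuit.cost (toffoli e P n m pu pv) .hadamard = 2 ∧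
    QCircuit.depth (toffoli e P n m pu pv) .tgate ≤ 2 := by
  have h1 := length_filter_kind_eq_cnot (he.isNeighborCnot_toffoliPre (P := P) (n := n) (by omega))
  have h2 := length_filter_kind_eq_cnot (he.isNeighborCnot_toffoliMid h)
  have h3 := length_filter_kind_eq_cnot (he.isNeighborCnot_toffoliPost (P := P) (n := n) (by omega))
  have l1 : (toffoliPre e P n).length = n + 1 := by simp [toffoliPre, length_cascade]
  have l2 : (toffoliMid e P n m).length = 2 * m + 3 := by simp [toffoliMid, length_fanOut]
  have l3 : (toffoliPost e P n).length = n + 1 := by simp [toffoliPost, length_cascade]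
  have key : ∀ κ, QCircuit.cost (toffoli e P n m pu pv) κ =
      (if κ = .cnot then 2 * n + 2 * m + 5 else 0) + (if κ = .tgate then 4 else 0) +
      (if κ = .hadamard then 2 else 0) := by
    intro κ
    have hT : ∀ s s', ((toffoliSlot e P n s s').filter fun g => g.kind = κ).length =
        if κ = .tgate then 2 else 0 := by
      intro s s'
      cases κ <;> simp [toffoliSlot, signedT_kind]
    rw [QCircuit.cost, flatten_toffoli, toffoliCore]
    simp only [List.filter_append, List.length_append, h1, h2, h3, l1, l2, l3, hT]
    cases κ <;> (simp [QGate.kind]; try omega)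
  refine ⟨?_, ?_, ?_, ?_, ?_⟩
  · rw [key]; rfl
  · rw [key]; simp
  · rw [key]; rfl
  · rw [key]; rfl
  · have hs : ∀ l : List (QGate k), (∀ g ∈ l, g.kind ≠ .tgate) →
        QCircuit.depth (QCircuit.serial l) .tgate = 0 := by
      intro l hl
      refine Nat.le_zero.1 ((QCircuit.depth_le_cost _ _).trans ?_)
      rw [QCircuit.cost_serial, List.filter_eq_nil_iff.2, List.length_nil]
      intro g hg
      simpa using hl g hg
    have hc : ∀ l : List (QGate k), (∀ g ∈ l, g.IsNeighborCnot) → ∀ g ∈ l, g.kind ≠ .tgate :=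
      fun l hl g hg => by rw [(hl g hg).kind_eq]; decide
    rw [toffoli, QCircuit.depth_append, QCircuit.depth_append, QCircuit.depth_append,
      QCircuit.depth_append, hs _ (hc _ (he.isNeighborCnot_toffoliMid h)), hs, hs]
    · have := QCircuit.depth_le_length [toffoliSlot e P n 0 pu] .tgate
      have := QCircuit.depth_le_length [toffoliSlot e P n pv (pu + pv)] .tgate
      simp only [List.length_singleton] at *
      omega
    · intro g hg
      rcases List.mem_append.1 hg with hg | hg
      · exact hc _ (he.isNeighborCnot_toffoliPost (by omega)) g hg
      · rw [List.mem_singleton.1 hg]; simp [QGate.kind]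
    · intro g hg
      rcases List.mem_cons.1 hg with rfl | hg
      · simp [QGate.kind]
      · exact hc _ (he.isNeighborCnot_toffoliPre (by omega)) g hg

end Toffoli

/-! ### The conjunction of the controls in two qubits -/

section Chain

variable {k : ℕ} {e : ℕ → Fin k}

/-- `toffoli` with target `p` and controls `q` and `r`, for `p < q < r`. -/
def toffoliAt (e : ℕ → Fin k) (p q r : ℕ) (pu pv : Fin 2) : QCircuit k :=
  toffoli e p (q - p - 1) (r - q - 1) pu pv

theorem IsLine.mapsBasis_toffoliAt (he : IsLine e) {p q r : ℕ} (hpq : p < q) (hqr : q < r)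
    (hr : r < k) (pu pv : Fin 2) : ∃ F : QBasis k → QBasis k,
      MapsBasis (QCircuit.op (toffoliAt e p q r pu pv)) F ∧
      ∀ y, ∀ i < k, F y (e i) =
        if i = p then y (e p) + (if y (e q) = pu ∧ y (e r) = pv then 1 else 0)
        else if q ≤ i + 1 ∧ i < r ∧ i ≠ q then y (e i) + y (e r)
        else y (e i) := by
  obtain ⟨n, rfl⟩ : ∃ n, q = p + n + 1 := ⟨q - p - 1, by omega⟩
  obtain ⟨m, rfl⟩ : ∃ m, r = p + n + m + 2 := ⟨r - (p + n + 1) - 1, by omega⟩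
  obtain ⟨F, hF, h⟩ := he.mapsBasis_toffoli (P := p) (n := n) (m := m) hr pu pv
  refine ⟨F, ?_, fun y i hi => ?_⟩
  · rw [toffoliAt, show p + n + 1 - p - 1 = n by omega,
      show p + n + m + 2 - (p + n + 1) - 1 = m by omega]
    exact hF
  · rw [h y i hi]
    have : (p + n ≤ i ∧ i ≤ p + n + m + 1 ∧ i ≠ p + n + 1) ↔
        (p + n + 1 ≤ i + 1 ∧ i < p + n + m + 2 ∧ i ≠ p + n + 1) := by omega
    simp only [this]

theorem IsLine.cost_toffoliAt (he : IsLine e) {p q r : ℕ} (hpq : p < q) (hqr : q < r)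
    (hr : r < k) (pu pv : Fin 2) :
    QCircuit.IsLNN (toffoliAt e p q r pu pv) ∧
    QCircuit.IsParallel (toffoliAt e p q r pu pv) ∧
    QCircuit.cost (toffoliAt e p q r pu pv) .rot = 0 ∧
    QCircuit.cost (toffoliAt e p q r pu pv) .cnot = 2 * (r - p) + 1 ∧
    QCircuit.cost (toffoliAt e p q r pu pv) .tgate = 4 ∧
    QCircuit.cost (toffoliAt e p q r pu pv) .hadamard = 2 ∧
    QCircuit.depth (toffoliAt e p q r pu pv) .tgate ≤ 2 := by
  have h : p + (q - p - 1) + (r - q - 1) + 2 < k := by omega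
  obtain ⟨h1, h2, h3, h4, h5⟩ := he.cost_toffoli h pu pv
  exact ⟨he.isLNN_toffoli h pu pv, he.isParallel_toffoli (by omega) _ pu pv, h1,
    h2.trans (by omega), h3, h4, h5⟩

/-- The change of the first qubit of a chain with `m` controls when all controls are `1`. -/
def chainFlip (m : ℕ) : Fin 2 := if m ≤ 1 then 0 else 1

/-- The value of the first control of a chain with `m` controls, after the chain, when all controls
are `1`. -/
def chainValue (m : ℕ) : Fin 2 := if m ≤ 2 then 1 else 0

/-- The chain of Toffoli gates for a first qubit `p` and the controls `q, r, s, …` after it. It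
flips `p` when `q` and `r` are `1`. Given this, `q` and `r` are known to be `1`: `r` is the first
qubit of a chain for the controls `s, …`, and `q` is the target of a gate that tests the two
qubits with the result of this chain. -/
def chain (e : ℕ → Fin k) : List ℕ → QCircuit k
  | [p, q, r] => toffoliAt e p q r 1 1
  | p :: q :: r :: s :: tl => toffoliAt e p q r 1 1 ++ (chain e (r :: s :: tl) ++
      toffoliAt e q r s (1 + chainFlip (tl.length + 1)) (chainValue (tl.length + 1)))
  | _ => []

theorem QCircuit.op_append (c c' : QCircuit k) :
    QCircuit.op (c ++ c') = QCircuit.op c' * QCircuit.op c := by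
  rw [QCircuit.op, List.flatten_append, QCircuit.opOfGates_append]; rfl

/-- After the chain, the first two of its qubits `p` and `q` tell whether all controls were `1`, and
in this case the other qubits, if they are not controls, have changed by constants.

In the inductive step for `p, q, r, s, …`, the first gate records in `p` whether `q` and `r` are
`1`. The chain for `r, s, …` then tells by the values of `r` and `s` whether the remaining controls
are `1`, provided that `r` was `1`, and the last gate records this in `q`, provided that `q` was
`1`. If one of the two was `0`, then `p` already has the wrong value. -/
theorem IsLine.mapsBasis_chain (he : IsLine e) : ∀ (p q : ℕ) (tl : List ℕ),
    (p :: q :: tl).Pairwise (· < ·) → (∀ x ∈ p :: q :: tl, x < k) →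
    ∃ F : QBasis k → QBasis k, MapsBasis (QCircuit.op (chain e (p :: q :: tl))) F ∧
      (∀ y, ∀ i < p, F y (e i) = y (e i)) ∧
      (∀ y, (F y (e p) = y (e p) + chainFlip (tl.length + 1) ∧
        F y (e q) = chainValue (tl.length + 1)) ↔ ∀ x ∈ q :: tl, y (e x) = 1) ∧
      ∃ a : ℕ → Fin 2, ∀ y, (∀ x ∈ q :: tl, y (e x) = 1) →
        ∀ i < k, i ∉ p :: q :: tl → F y (e i) = y (e i) + a i
  | p, q, [], _, _ => by
    refine ⟨id, ?_, fun _ _ _ => rfl, fun y => ?_, fun _ => 0, fun y _ i _ _ => (add_zero _).symm⟩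
    · exact mapsBasis_one
    · simp [chainFlip, chainValue]
  | p, q, [r], hs, hk => by
    simp only [List.pairwise_cons, List.mem_cons, forall_eq_or_imp] at hs hk
    obtain ⟨F, hF, h⟩ := he.mapsBasis_toffoliAt (p := p) (q := q) (r := r) (by omega) (by omega)
      (by omega) 1 1
    refine ⟨F, hF, fun y i hi => ?_, fun y => ?_,
      fun i => if q ≤ i + 1 ∧ i < r ∧ i ≠ q then 1 else 0, fun y hy i hi hi' => ?_⟩
    · rw [h y i (by omega), if_neg (by omega), if_neg (by omega)]
    · have hp := h y p (by omega)
      have hq := h y q (by omega)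
      rw [if_pos rfl] at hp
      rw [if_neg (by omega), if_neg (by omega)] at hq
      rw [hp, hq]
      clear hp hq h
      have hc : chainFlip ([r].length + 1) = 1 := rfl
      have hv : chainValue ([r].length + 1) = 1 := rfl
      rw [hc, hv, List.forall_mem_cons, List.forall_mem_singleton]
      generalize y (e p) = a
      generalize y (e q) = b
      generalize y (e r) = c
      revert a b c; decide
    · simp only [List.mem_cons, List.not_mem_nil, or_false, not_or] at hi'
      rw [h y i hi, if_neg hi'.1, hy r (by simp)]
      by_cases c : q ≤ i + 1 ∧ i < r ∧ i ≠ q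
      · simp only [if_pos c]
      · simp only [if_neg c, add_zero]
  | p, q, r :: s :: tl, hs, hk => by
    obtain ⟨F₂, hF₂, h₂, h₂', a, ha⟩ := he.mapsBasis_chain r s tl
      (List.Pairwise.of_cons (List.Pairwise.of_cons hs)) (fun x hx => hk x (by simp [hx]))
    have hx : ∀ x ∈ s :: tl, r < x := (List.pairwise_cons.1
      (List.Pairwise.of_cons (List.Pairwise.of_cons hs))).1
    simp only [List.pairwise_cons, List.mem_cons, forall_eq_or_imp] at hs hk
    obtain ⟨F₁, hF₁, h₁⟩ := he.mapsBasis_toffoliAt (p := p) (q := q) (r := r) (by omega) (by omega)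
      (by omega) 1 1
    obtain ⟨F₃, hF₃, h₃⟩ := he.mapsBasis_toffoliAt (p := q) (q := r) (r := s) (by omega) (by omega)
      (by omega) (1 + chainFlip (tl.length + 1)) (chainValue (tl.length + 1))
    have hF₁x : ∀ y, ∀ x ∈ r :: s :: tl, F₁ y (e x) = y (e x) := by
      intro y x hx'
      have : r ≤ x := by
        rcases List.mem_cons.1 hx' with rfl | hx'
        exacts [le_rfl, (hx x hx').le]
      have : x < k := by
        simp only [List.mem_cons] at hx'
        rcases hx' with rfl | rfl | hx'
        exacts [by omega, by omega, hk.2.2.2.2 x hx']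
      rw [h₁ y x (by omega), if_neg (by omega), if_neg (by omega)]
    have hall : ∀ y, (∀ x ∈ s :: tl, F₁ y (e x) = 1) ↔ ∀ x ∈ s :: tl, y (e x) = 1 := fun y =>
      forall₂_congr fun x hx' => by rw [hF₁x y x (List.mem_cons_of_mem _ hx')]
    refine ⟨F₃ ∘ F₂ ∘ F₁, ?_, fun y i hi => ?_, fun y => ?_,
      fun i => (if q ≤ i + 1 ∧ i < r ∧ i ≠ q then 1 else 0) + a i +
        (if r ≤ i + 1 ∧ i < s ∧ i ≠ r then chainValue (tl.length + 1) else 0),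
      fun y hy i hi hi' => ?_⟩
    · rw [chain, QCircuit.op_append, QCircuit.op_append]
      exact hF₁.mul (hF₂.mul hF₃)
    · simp only [Function.comp]
      rw [h₃ _ i (by omega), if_neg (by omega), if_neg (by omega), h₂ _ i (by omega),
        h₁ _ i (by omega), if_neg (by omega), if_neg (by omega)]
    · simp only [Function.comp]
      have hp : F₃ (F₂ (F₁ y)) (e p) =
          y (e p) + if y (e q) = 1 ∧ y (e r) = 1 then 1 else 0 := by
        rw [h₃ _ p (by omega), if_neg (by omega), if_neg (by omega), h₂ _ p (by omega),
          h₁ _ p (by omega), if_pos rfl]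
      have hq : F₃ (F₂ (F₁ y)) (e q) = y (e q) +
          if F₂ (F₁ y) (e r) = 1 + chainFlip (tl.length + 1) ∧
            F₂ (F₁ y) (e s) = chainValue (tl.length + 1) then 1 else 0 := by
        rw [h₃ _ q (by omega), if_pos rfl, h₂ _ q (by omega),
          h₁ _ q (by omega), if_neg (by omega), if_neg (by omega)]
      have hrec := h₂' (F₁ y)
      rw [hall, hF₁x y r (by simp)] at hrec
      rw [hp, hq, List.forall_mem_cons, List.forall_mem_cons, ← hrec]
      have hc : chainFlip ((r :: s :: tl).length + 1) = 1 := by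
        simp [chainFlip]
      have hv : chainValue ((r :: s :: tl).length + 1) = 0 := by
        simp [chainValue]
      rw [hc, hv]
      generalize y (e p) = a₀
      generalize y (e q) = b
      generalize y (e r) = c
      generalize F₂ (F₁ y) (e r) = d
      generalize F₂ (F₁ y) (e s) = f
      generalize chainFlip (tl.length + 1) = g
      generalize chainValue (tl.length + 1) = j
      clear hrec
      revert a₀ b c d f g j; decide
    · simp only [List.mem_cons, not_or] at hi'
      have hy' : ∀ x ∈ s :: tl, F₁ y (e x) = 1 :=
        (hall y).2 fun x hx' => hy x (by simp only [List.mem_cons] at hx' ⊢; tauto)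
      simp only [Function.comp]
      rw [h₃ _ i hi, if_neg hi'.2.1, ((h₂' (F₁ y)).2 hy').2,
        ha (F₁ y) hy' i hi (by simp only [List.mem_cons, not_or]; tauto),
        h₁ _ i hi, if_neg hi'.1, hy r (by simp)]
      by_cases c1 : q ≤ i + 1 ∧ i < r ∧ i ≠ q <;> by_cases c2 : r ≤ i + 1 ∧ i < s ∧ i ≠ r
      · simp only [if_pos c1, if_pos c2, add_assoc]
      · simp only [if_pos c1, if_neg c2, add_assoc, add_zero]
      · simp only [if_neg c1, if_pos c2, add_assoc, zero_add]
      · simp only [if_neg c1, if_neg c2, add_zero, zero_add]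

/-- The resources of the chain. The sum of the distances between the targets and the controls of
its gates telescopes. -/
theorem IsLine.cost_chain (he : IsLine e) (E : ℕ) (hE : E < k) : ∀ (p q : ℕ) (tl : List ℕ),
    (p :: q :: tl).Pairwise (· < ·) → (∀ x ∈ p :: q :: tl, x ≤ E) →
    QCircuit.IsLNN (chain e (p :: q :: tl)) ∧
    QCircuit.IsParallel (chain e (p :: q :: tl)) ∧
    QCircuit.cost (chain e (p :: q :: tl)) .rot = 0 ∧
    QCircuit.cost (chain e (p :: q :: tl)) .cnot + 2 * p + 2 * q + 2 ≤ 4 * E + tl.length ∧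
    QCircuit.cost (chain e (p :: q :: tl)) .tgate = 4 * tl.length ∧
    QCircuit.cost (chain e (p :: q :: tl)) .hadamard = 2 * tl.length ∧
    QCircuit.depth (chain e (p :: q :: tl)) .tgate ≤ 2 * tl.length
  | p, q, [], hs, hk => by
    simp only [List.pairwise_cons, List.mem_cons, forall_eq_or_imp] at hs hk
    simp only [chain, QCircuit.IsLNN, QCircuit.IsParallel, List.not_mem_nil, false_imp_iff,
      implies_true, QCircuit.cost, QCircuit.depth, List.flatten_nil, List.filter_nil,
      List.length_nil, true_and]
    omega
  | p, q, [r], hs, hk => by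
    simp only [List.pairwise_cons, List.mem_cons, forall_eq_or_imp] at hs hk
    obtain ⟨h1, h2, h3, h4, h5, h6, h7⟩ := he.cost_toffoliAt (p := p) (q := q) (r := r) (by omega)
      (by omega) (by omega) 1 1
    refine ⟨h1, h2, h3, ?_, h5, h6, h7⟩
    rw [chain, h4, List.length_singleton]
    omega
  | p, q, r :: s :: tl, hs, hk => by
    obtain ⟨i1, i2, i3, i4, i5, i6, i7⟩ := he.cost_chain E hE r s tl
      (List.Pairwise.of_cons (List.Pairwise.of_cons hs)) (fun x hx => hk x (by simp [hx]))
    simp only [List.pairwise_cons, List.mem_cons, forall_eq_or_imp] at hs hk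
    obtain ⟨h1, h2, h3, h4, h5, h6, h7⟩ := he.cost_toffoliAt (p := p) (q := q) (r := r) (by omega)
      (by omega) (by omega) 1 1
    obtain ⟨j1, j2, j3, j4, j5, j6, j7⟩ := he.cost_toffoliAt (p := q) (q := r) (r := s) (by omega)
      (by omega) (by omega) (1 + chainFlip (tl.length + 1)) (chainValue (tl.length + 1))
    refine ⟨QCircuit.isLNN_append h1 (QCircuit.isLNN_append i1 j1),
      QCircuit.isParallel_append h2 (QCircuit.isParallel_append i2 j2), ?_⟩
    simp only [chain, QCircuit.cost_append, QCircuit.depth_append, List.length_cons]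
    omega

end Chain

/-! ### Moving the value of a qubit along the line -/

section Transport

variable {k : ℕ}

/-- One time slot of `transport`: two CNOT gates, one of each of two cascades of which the second
follows two qubits behind the first. -/
def transportSlot (w : ℕ → Fin k) (r j : ℕ) : List (QGate k) :=
  (if j < r then [QGate.cnot (w (j + 1)) (w j)] else []) ++
    if 2 ≤ j then [QGate.cnot (w (j - 2)) (w (j - 1))] else []

/-- A circuit that moves the value of qubit `w 0` along the path `w 0, …, w r` to its other end. It
is added to the values of the other qubits, which move by one qubit in the other direction. -/
def transport (w : ℕ → Fin k) (r : ℕ) : QCircuit k :=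
  (List.range (r + 2)).map (transportSlot w r)

/-- The qubits `w 0, …, w r` are distinct, and successive ones are adjacent. -/
structure IsPath (w : ℕ → Fin k) (r : ℕ) : Prop where
  inj : ∀ i ≤ r, ∀ j ≤ r, w i = w j → i = j
  adj : ∀ i < r, (w i).val + 1 = (w (i + 1)).val ∨ (w (i + 1)).val + 1 = (w i).val

variable {w : ℕ → Fin k} {r : ℕ}

theorem IsPath.isNeighborCnot_transport (hw : IsPath w r) :
    ∀ L ∈ transport w r, ∀ g ∈ L, g.IsNeighborCnot := by
  intro L hL g hg
  obtain ⟨j, hj, rfl⟩ := List.mem_map.1 hL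
  have hj := List.mem_range.1 hj
  rcases List.mem_append.1 hg with hg | hg
  · split_ifs at hg with h
    · rw [List.mem_singleton.1 hg]
      exact ⟨_, _, rfl, (hw.adj j h).symm⟩
    · simp at hg
  · split_ifs at hg with h
    · rw [List.mem_singleton.1 hg]
      refine ⟨_, _, rfl, ?_⟩
      have := hw.adj (j - 2) (by omega)
      rwa [show j - 2 + 1 = j - 1 by omega] at this
    · simp at hg

theorem IsPath.isLNN_transport (hw : IsPath w r) : QCircuit.IsLNN (transport w r) :=
  fun L hL g hg => (hw.isNeighborCnot_transport L hL g hg).isLNN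

theorem IsPath.isParallel_transport (hw : IsPath w r) : QCircuit.IsParallel (transport w r) := by
  intro L hL
  obtain ⟨j, hj, rfl⟩ := List.mem_map.1 hL
  have hj := List.mem_range.1 hj
  by_cases h1 : j < r <;> by_cases h2 : 2 ≤ j <;> simp only [transportSlot, h1, h2, if_true,
    if_false, List.append_nil, List.nil_append, List.pairwise_singleton, List.Pairwise.nil]
  simp only [List.singleton_append, List.pairwise_cons, List.mem_singleton, forall_eq,
    List.not_mem_nil, false_imp_iff, implies_true, List.Pairwise.nil, and_true, QGate.qubits]
  have hne : ∀ i ≤ r, ∀ j ≤ r, i ≠ j → w i ≠ w j := fun i hi j hj h h' => h (hw.inj i hi j hj h')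
  simp only [Finset.disjoint_insert_left, Finset.disjoint_singleton_left, Finset.mem_insert,
    Finset.mem_singleton, not_or]
  exact ⟨⟨hne _ (by omega) _ (by omega) (by omega), hne _ (by omega) _ (by omega) (by omega)⟩,
    hne _ (by omega) _ (by omega) (by omega), hne _ (by omega) _ (by omega) (by omega)⟩

theorem IsPath.cost_transport (hw : IsPath w r) (κ : GateKind) :
    QCircuit.cost (transport w r) κ = if κ = .cnot then 2 * r else 0 := by
  rw [QCircuit.cost, length_filter_kind_eq_cnot]
  · congr 1
    have : ∀ j, ((List.range j).map (transportSlot w r)).flatten.length = min j r + (j - 2) := by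
      intro j
      induction j with
      | zero => simp
      | succ j ih =>
        rw [List.range_succ, List.map_append, List.flatten_append, List.length_append, ih]
        by_cases h1 : j < r <;> by_cases h2 : 2 ≤ j <;> simp [transportSlot, h1, h2] <;> omega
    rw [transport, this]
    omega
  · intro g hg
    obtain ⟨L, hL, hg⟩ := List.mem_flatten.1 hg
    exact hw.isNeighborCnot_transport L hL g hg

theorem depth_transport (κ : GateKind) : QCircuit.depth (transport w r) κ ≤ r + 2 :=
  (QCircuit.depth_le_length _ _).trans (by simp [transport])

theorem actList_transportSlot_of_ne (q : Fin k) (hq : ∀ i ≤ r, q ≠ w i) {j : ℕ} (hj : j < r + 2)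
    (y : QBasis k) : actList (transportSlot w r j) y q = y q := by
  by_cases h1 : j < r <;> by_cases h2 : 2 ≤ j <;>
    simp only [transportSlot, h1, h2, if_true, if_false, List.append_nil, List.nil_append,
      List.singleton_append, actList, QGate.act]
  · rw [Function.update_of_ne (hq _ (by omega)), Function.update_of_ne (hq _ (by omega))]
  · rw [Function.update_of_ne (hq _ (by omega))]
  · rw [Function.update_of_ne (hq _ (by omega))]

theorem IsPath.actList_transportSlot (hw : IsPath w r) {i j : ℕ} (hi : i ≤ r) (hj : j < r + 2)
    (z : QBasis k) : actList (transportSlot w r j) z (w i) =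
      if i = j ∧ j < r then z (w j) + z (w (j + 1))
      else if i + 1 = j ∧ 2 ≤ j then z (w i) + z (w (i - 1))
      else z (w i) := by
  have hupd : ∀ (z : QBasis k) (c q : ℕ), q ≤ r → (QGate.cnot (w c) (w q)).act z (w i) =
      if i = q then z (w q) + z (w c) else z (w i) := by
    intro z c q hq
    by_cases h : i = q
    · subst h; simp [QGate.act]
    · rw [if_neg h]
      exact Function.update_of_ne (fun h' => h (hw.inj i hi q hq h')) _ _
  have hupd' : ∀ (z : QBasis k) (c q p : ℕ), q ≤ r → p ≤ r → p ≠ q →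
      (QGate.cnot (w c) (w q)).act z (w p) = z (w p) := fun z c q p hq hp h =>
    Function.update_of_ne (fun h' => h (hw.inj p hp q hq h')) _ _
  by_cases h1 : j < r <;> by_cases h2 : 2 ≤ j <;>
    simp only [transportSlot, h1, h2, if_true, if_false, List.append_nil, List.nil_append,
      List.singleton_append, actList_cons, actList_nil, and_true, and_false]
  · rw [hupd _ _ _ (by omega), hupd' _ _ _ _ (by omega) (by omega) (by omega),
      hupd' _ _ _ _ (by omega) (by omega) (by omega), hupd _ _ _ (by omega)]
    by_cases h3 : i + 1 = j
    · subst h3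
      rw [if_pos (by omega), if_neg (by omega), if_pos rfl]
      rfl
    · rw [if_neg (by omega), if_neg (c := i + 1 = j) (by omega)]
  · rw [hupd _ _ _ (by omega)]
  · rw [hupd _ _ _ (by omega)]
    by_cases h3 : i + 1 = j
    · subst h3
      rw [if_pos (by omega), if_pos rfl]
      rfl
    · rw [if_neg (by omega), if_neg h3]

theorem actList_transport_of_ne (q : Fin k) (hq : ∀ i ≤ r, q ≠ w i) (y : QBasis k) :
    actList (transport w r).flatten y q = y q := by
  have : ∀ j ≤ r + 2, actList ((List.range j).map (transportSlot w r)).flatten y q = y q := by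
    intro j hj
    induction j with
    | zero => rfl
    | succ j ih =>
      rw [List.range_succ, List.map_append, List.flatten_append, actList_append, List.map_singleton,
        List.flatten_singleton, actList_transportSlot_of_ne q hq (by omega), ih (by omega)]
  exact this _ le_rfl

theorem IsPath.actList_transport (hw : IsPath w r) {i : ℕ} (hi : i ≤ r) (y : QBasis k) :
    actList (transport w r).flatten y (w i) =
      if i = r then y (w 0) else y (w 0) + y (w (i + 1)) := by
  obtain ⟨X, hX⟩ : ∃ X : ℕ → Fin 2, X = fun i => if i ≤ r then y (w i) else 0 := ⟨_, rfl⟩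
  have hX1 : ∀ i ≤ r, X i = y (w i) := fun i hi => by rw [hX]; exact if_pos hi
  have hX2 : X (r + 1) = 0 := by rw [hX]; exact if_neg (by omega)
  -- the values after `j` slots: the second cascade has passed qubit `i` if `i + 2 ≤ j`
  have key : ∀ j ≤ r + 2, ∀ i ≤ r,
      actList ((List.range j).map (transportSlot w r)).flatten y (w i) =
        if i + 2 ≤ j then X 0 + X (i + 1) else if i + 1 = j then X i + X (i + 1) else X i := by
    intro j hj
    induction j with
    | zero => intro i hi; simp [actList, hX1 i hi]
    | succ j ih =>
      intro i hi
      have ih := ih (by omega)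
      rw [List.range_succ, List.map_append, List.flatten_append, actList_append, List.map_singleton,
        List.flatten_singleton, hw.actList_transportSlot hi (by omega)]
      by_cases h1 : i = j
      · subst h1
        by_cases h2 : i < r
        · rw [if_pos ⟨rfl, h2⟩, ih _ (by omega), ih _ (by omega), if_neg (by omega),
            if_neg (by omega), if_neg (by omega), if_neg (by omega),
            if_neg (c := i + 2 ≤ i + 1) (by omega), if_pos rfl]
        · rw [if_neg (by omega), if_neg (by omega), ih _ (by omega), if_neg (by omega),
            if_neg (by omega), if_neg (by omega), if_pos rfl, show i = r by omega, hX2, add_zero]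
      · rw [if_neg (by omega)]
        by_cases h2 : i + 1 = j
        · subst h2
          by_cases h3 : 2 ≤ i + 1
          · rw [if_pos ⟨rfl, h3⟩, ih _ (by omega), ih _ (by omega), if_neg (by omega), if_pos rfl,
              if_pos (by omega), if_pos (by omega), show i - 1 + 1 = i by omega]
            have : ∀ a b c : Fin 2, a + b + (c + a) = c + b := by decide
            exact this _ _ _
          · rw [if_neg (by omega), ih _ (by omega), if_neg (by omega), if_pos rfl,
              if_pos (by omega), show i = 0 by omega]
        · rw [if_neg (by omega), ih i hi]
          by_cases h3 : i + 2 ≤ j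
          · rw [if_pos h3, if_pos (by omega)]
          · rw [if_neg h3, if_neg (by omega), if_neg (by omega), if_neg (by omega)]
  rw [transport, key _ le_rfl i hi, if_pos (by omega), hX1 0 (by omega)]
  by_cases h : i = r
  · rw [if_pos h, h, hX2, add_zero]
  · rw [if_neg h, hX1 _ (by omega)]

theorem IsPath.mapsBasis_transport (hw : IsPath w r) :
    MapsBasis (QCircuit.op (transport w r)) (actList (transport w r).flatten) := by
  refine mapsBasis_opOfGates (fun g hg => ?_) fun g hg => ?_ <;>
    obtain ⟨L, hL, hg⟩ := List.mem_flatten.1 hg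
  · exact (hw.isNeighborCnot_transport L hL g hg).isMonomial
  · exact (hw.isNeighborCnot_transport L hL g hg).isLNN

end Transport

/-! ### Diagonal operators on three adjacent qubits -/

section Diagonal

variable {k : ℕ}

/-- Rotations of the seven nonzero parities of three adjacent qubits. -/
noncomputable def diagonalGates (q₀ q₁ q₂ : Fin k) (θ : Fin 7 → ℝ) : List (QGate k) :=
  [.rz (θ 0) q₀, .rz (θ 1) q₁, .rz (θ 2) q₂, .cnot q₀ q₁, .rz (θ 3) q₁, .cnot q₁ q₂,
    .rz (θ 4) q₂, .cnot q₀ q₁, .cnot q₁ q₂, .rz (θ 5) q₂, .cnot q₀ q₁, .cnot q₁ q₂, .rz (θ 6) q₂,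
    .cnot q₀ q₁, .cnot q₁ q₂]

theorem isLNN_diagonalGates {q₀ q₁ q₂ : Fin k} (h01 : (QGate.cnot q₀ q₁).IsLNN)
    (h12 : (QGate.cnot q₁ q₂).IsLNN) (θ : Fin 7 → ℝ) :
    ∀ g ∈ diagonalGates q₀ q₁ q₂ θ, g.IsLNN := by
  simp only [diagonalGates, List.forall_mem_cons]
  exact ⟨trivial, trivial, trivial, h01, trivial, h12, trivial, h01, h12, trivial, h01, h12,
    trivial, h01, h12, fun _ h => absurd h List.not_mem_nil⟩

theorem isMonomial_diagonalGates (q₀ q₁ q₂ : Fin k) (θ : Fin 7 → ℝ) :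
    ∀ g ∈ diagonalGates q₀ q₁ q₂ θ, g.IsMonomial := by
  simp [diagonalGates, QGate.IsMonomial]

theorem rzMatrix_apply_self (θ : ℝ) (b : Fin 2) :
    rzMatrix θ b b = Complex.exp (-(Complex.I * θ / 2) * bitSign b) := by
  fin_cases b
  · simp [rzMatrix, bitSign, neg_div]
  · simp [rzMatrix, bitSign]

/-- Every diagonal operator on three adjacent qubits is, up to a global phase, a product of `R_z`
rotations of the parities: the angles are the Fourier coefficients of its phase. -/
theorem exists_diagonalGates (q₀ q₁ q₂ : Fin k) (h01 : (QGate.cnot q₀ q₁).IsLNN)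
    (h12 : (QGate.cnot q₁ q₂).IsLNN) (h02 : q₀ ≠ q₂) (f : Fin 2 → Fin 2 → Fin 2 → ℝ) :
    ∃ (θ : Fin 7 → ℝ) (z : ℂ), ‖z‖ = 1 ∧ ∀ x y,
      QCircuit.opOfGates (diagonalGates q₀ q₁ q₂ θ) x y =
        if x = y then z * Complex.exp (Complex.I * f (y q₀) (y q₁) (y q₂)) else 0 := by
  have n01 := QGate.IsLNN.ne h01
  have n12 := QGate.IsLNN.ne h12
  obtain ⟨σ, hσ⟩ : ∃ σ : Fin 2 → ℝ, ∀ b, σ b = if b = 1 then -1 else 1 := ⟨_, fun _ => rfl⟩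
  have hsign : ∀ b, bitSign b = (σ b : ℂ) := by
    intro b; rw [hσ]; unfold bitSign; split_ifs <;> simp
  obtain ⟨c, hc⟩ : ∃ c : (Fin 2 → Fin 2 → Fin 2 → Fin 2) → ℝ, ∀ p, c p =
      (1 / 8) * ∑ a, ∑ b, ∑ d, σ (p a b d) * f a b d := ⟨_, fun _ => rfl⟩
  -- `c p` is the Fourier coefficient of `f` at the parity `p`; the factor `-2` undoes that of `R_z`
  refine ⟨fun i => -2 * c (![fun a _ _ => a, fun _ b _ => b, fun _ _ d => d, fun a b _ => a + b,
    fun a b d => a + b + d, fun a _ d => a + d, fun _ b d => b + d] i),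
    Complex.exp (Complex.I * (-c (fun _ _ _ => 0) : ℝ)), ?_, fun x y => ?_⟩
  · rw [mul_comm, Complex.norm_exp_ofReal_mul_I]
  · rw [opOfGates_apply (isMonomial_diagonalGates q₀ q₁ q₂ _) (isLNN_diagonalGates h01 h12 _)]
    have hact : ∀ θ, actList (diagonalGates q₀ q₁ q₂ θ) y = y := by
      intro θ
      have hcancel : ∀ a b d : Fin 2, b + a + a + a + a = b ∧
          d + (b + a) + (b + a + a) + (b + a + a + a) + (b + a + a + a + a) = d := by decide
      funext j
      simp only [diagonalGates, actList, QGate.act, Function.update_self,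
        Function.update_of_ne n01, Function.update_of_ne n12, Function.update_of_ne h02,
        Function.update_of_ne n12.symm]
      by_cases h2 : j = q₂
      · subst h2
        simp only [Function.update_self]
        exact (hcancel _ _ _).2
      · by_cases h1 : j = q₁
        · subst h1
          simp only [Function.update_self, Function.update_of_ne h2]
          exact (hcancel _ _ 0).1
        · simp only [Function.update_of_ne h1, Function.update_of_ne h2]
    rw [hact]
    congr 1
    simp only [diagonalGates, phaseList, QGate.phase, QGate.act, Function.update_self,
        Function.update_of_ne n01, Function.update_of_ne n12, Function.update_of_ne h02,
        Function.update_of_ne n12.symm, one_mul, mul_one, rzMatrix_apply_self, hsign,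
        ← Complex.exp_add]
    congr 1
    generalize y q₀ = a
    generalize y q₁ = b
    generalize y q₂ = d
    have hs0 : σ 0 = 1 := by simp [hσ]
    have hs1 : σ 1 = -1 := by simp [hσ]
    have h11 : (1 : Fin 2) + 1 = 0 := by decide
    simp only [hc, Fin.sum_univ_two]
    fin_cases a <;> fin_cases b <;> fin_cases d <;>
      simp [hs0, hs1, h11] <;> ring

end Diagonal

/-! ### Diagonalization of a unitary `2 × 2` matrix by rotations -/

/-- Every unit vector of `ℂ²` is, up to a phase, the first column of `R_z(a) R_x(b)`. -/
theorem exists_rotation_column (v₀ v₁ : ℂ) (hv : ‖v₀‖ ^ 2 + ‖v₁‖ ^ 2 = 1) :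
    ∃ (a b : ℝ) (w : ℂ), w ≠ 0 ∧ v₀ = w * (rzMatrix a * rxMatrix b) 0 0 ∧
      v₁ = w * (rzMatrix a * rxMatrix b) 1 0 := by
  -- the angles on the Bloch sphere: `cos (b / 2) = ‖v₀‖`, and `a` comes from the relative phase
  obtain ⟨c, hc0, hc1⟩ : ∃ c : ℝ, Real.cos c = ‖v₀‖ ∧ Real.sin c = ‖v₁‖ := by
    have h0 := norm_nonneg v₀
    refine ⟨Real.arccos ‖v₀‖, Real.cos_arccos (by linarith) (by nlinarith [norm_nonneg v₁]), ?_⟩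
    rw [Real.sin_arccos, show 1 - ‖v₀‖ ^ 2 = ‖v₁‖ ^ 2 by linarith, Real.sqrt_sq (norm_nonneg _)]
  obtain ⟨p, hp⟩ : ∃ p : ℝ, p = v₀.arg := ⟨_, rfl⟩
  obtain ⟨q, hq⟩ : ∃ q : ℝ, q = v₁.arg + Real.pi / 2 := ⟨_, rfl⟩
  have hI : Complex.exp (Real.pi / 2 * Complex.I) = Complex.I := Complex.exp_pi_div_two_mul_I
  have e0 : v₀ = ‖v₀‖ * Complex.exp (p * Complex.I) := by
    rw [hp]; exact (Complex.norm_mul_exp_arg_mul_I v₀).symm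
  have e1 : v₁ = -Complex.I * (‖v₁‖ * Complex.exp (q * Complex.I)) := by
    rw [hq]; push_cast
    rw [add_mul, Complex.exp_add, hI]
    linear_combination -(Complex.norm_mul_exp_arg_mul_I v₁) +
      ‖v₁‖ * Complex.exp (v₁.arg * Complex.I) * Complex.I_sq
  refine ⟨q - p, 2 * c, Complex.exp (((p + q) / 2 : ℝ) * Complex.I), Complex.exp_ne_zero _, ?_, ?_⟩
  · simp only [rzMatrix, rxMatrix, Matrix.mul_apply, Fin.sum_univ_two]
    simp only [Matrix.of_apply, Matrix.cons_val_zero, Matrix.cons_val_one, zero_mul, add_zero]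
    rw [show ((2 * c : ℝ) : ℂ) / 2 = (c : ℝ) by push_cast; ring, ← Complex.ofReal_cos, hc0,
      ← mul_assoc, ← Complex.exp_add]
    nth_rewrite 1 [e0]
    rw [mul_comm]
    congr 2
    push_cast; ring
  · simp only [rzMatrix, rxMatrix, Matrix.mul_apply, Fin.sum_univ_two]
    simp only [Matrix.of_apply, Matrix.cons_val_zero, Matrix.cons_val_one, zero_mul, zero_add]
    rw [show ((2 * c : ℝ) : ℂ) / 2 = (c : ℝ) by push_cast; ring, ← Complex.ofReal_sin, hc1,
      ← mul_assoc, ← Complex.exp_add]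
    nth_rewrite 1 [e1]
    rw [show Complex.I * ((q - p : ℝ) : ℂ) / 2 = ((q - p) / 2 : ℂ) * Complex.I by push_cast; ring]
    rw [show ((((p + q) / 2 : ℝ) : ℂ) * Complex.I + ((q - p) / 2 : ℂ) * Complex.I)
      = q * Complex.I by push_cast; ring]
    ring

theorem rzMatrix_mem_unitary (θ : ℝ) : rzMatrix θ ∈ Matrix.unitaryGroup (Fin 2) ℂ := by
  have h : star (rzMatrix θ) = rzMatrix (-θ) := by
    ext i j
    fin_cases i <;> fin_cases j <;>
      simp [rzMatrix, Matrix.star_apply, ← Complex.exp_conj, neg_div, map_ofNat]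
  rw [Matrix.mem_unitaryGroup_iff', h, rzMatrix_neg_mul]

theorem rxMatrix_mem_unitary (θ : ℝ) : rxMatrix θ ∈ Matrix.unitaryGroup (Fin 2) ℂ := by
  have h : star (rxMatrix θ) = rxMatrix (-θ) := by
    ext i j
    fin_cases i <;> fin_cases j <;>
      simp [rxMatrix, Matrix.star_apply, ← Complex.cos_conj, ← Complex.sin_conj, neg_div, map_ofNat]
  rw [Matrix.mem_unitaryGroup_iff', h, rxMatrix_neg_mul]

theorem exists_eq_exp_of_norm_eq_one {z : ℂ} (hz : ‖z‖ = 1) :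
    ∃ α : ℝ, z = Complex.exp (Complex.I * α) := by
  refine ⟨z.arg, ?_⟩
  rw [mul_comm]
  have := Complex.norm_mul_exp_arg_mul_I z
  rw [hz, Complex.ofReal_one, one_mul] at this
  exact this.symm

/-- A unitary matrix of which the first column is a multiple of `(1, 0)` is diagonal. -/
theorem unitary_eq_diagonal {D : Matrix (Fin 2) (Fin 2) ℂ}
    (hD : D ∈ Matrix.unitaryGroup (Fin 2) ℂ) (h : D 1 0 = 0) :
    ∃ α β : ℝ, D = !![Complex.exp (Complex.I * α), 0; 0, Complex.exp (Complex.I * β)] := by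
  have h1 := (Matrix.mem_unitaryGroup_iff').1 hD
  have h00 := congrFun (congrFun h1 0) 0
  have h01 := congrFun (congrFun h1 0) 1
  have h11 := congrFun (congrFun h1 1) 1
  simp only [Matrix.mul_apply, Fin.sum_univ_two, Matrix.star_apply, h, mul_zero, zero_mul,
    star_zero, add_zero, Matrix.one_apply_eq] at h00 h01 h11
  rw [Matrix.one_apply_ne (by decide)] at h01
  have hne : star (D 0 0) ≠ 0 := fun h0 => by simp [h0] at h00
  have hz : D 0 1 = 0 := (mul_eq_zero.1 h01).resolve_left hne
  rw [hz, mul_zero, zero_add] at h11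
  have hn : ∀ z : ℂ, star z * z = 1 → ‖z‖ = 1 := by
    intro z hz
    have h2 : ‖z‖ * ‖z‖ = 1 := by simpa using congrArg norm hz
    nlinarith [norm_nonneg z]
  obtain ⟨α, hα⟩ := exists_eq_exp_of_norm_eq_one (hn _ h00)
  obtain ⟨β, hβ⟩ := exists_eq_exp_of_norm_eq_one (hn _ h11)
  refine ⟨α, β, ?_⟩
  ext i j
  fin_cases i <;> fin_cases j
  · exact hα
  · exact hz
  · exact h
  · exact hβ

/-- A unitary matrix is diagonalized by `R_z(a) R_x(b)`, which turns the first basis vector into an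
eigenvector. -/
theorem exists_rotation_diagonalization {U : Matrix (Fin 2) (Fin 2) ℂ}
    (hU : U ∈ Matrix.unitaryGroup (Fin 2) ℂ) : ∃ a b α β : ℝ,
    U = rzMatrix a * rxMatrix b *
      !![Complex.exp (Complex.I * α), 0; 0, Complex.exp (Complex.I * β)] *
      (rxMatrix (-b) * rzMatrix (-a)) := by
  obtain ⟨μ, hμ⟩ := Module.End.exists_eigenvalue (Matrix.toLin' U)
  obtain ⟨v, hv⟩ := hμ.exists_hasEigenvector
  have hv0 := hv.2
  have hUv : U *ᵥ v = μ • v := by simpa using hv.apply_eq_smul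
  obtain ⟨N, hN⟩ : ∃ N : ℝ, N = Real.sqrt (‖v 0‖ ^ 2 + ‖v 1‖ ^ 2) := ⟨_, rfl⟩
  have hpos : 0 < ‖v 0‖ ^ 2 + ‖v 1‖ ^ 2 := by
    by_contra hcon
    have h0 : ‖v 0‖ ^ 2 = 0 := by nlinarith [sq_nonneg ‖v 0‖, sq_nonneg ‖v 1‖]
    have h1 : ‖v 1‖ ^ 2 = 0 := by nlinarith [sq_nonneg ‖v 0‖, sq_nonneg ‖v 1‖]
    refine hv0 (funext fun i => ?_)
    fin_cases i
    · simpa using h0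
    · simpa using h1
  have hNpos : 0 < N := by rw [hN]; exact Real.sqrt_pos.2 hpos
  have hNsq : N ^ 2 = ‖v 0‖ ^ 2 + ‖v 1‖ ^ 2 := by rw [hN]; exact Real.sq_sqrt hpos.le
  have hNc : (N : ℂ) ≠ 0 := by exact_mod_cast hNpos.ne'
  obtain ⟨a, b, w, hw, h0, h1⟩ := exists_rotation_column (v 0 / N) (v 1 / N) (by
    rw [norm_div, norm_div, Complex.norm_real, Real.norm_of_nonneg hNpos.le, div_pow, div_pow,
      ← add_div, hNsq, div_self hpos.ne'])
  obtain ⟨V, hV⟩ : ∃ V, V = rzMatrix a * rxMatrix b := ⟨_, rfl⟩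
  obtain ⟨V', hV'⟩ : ∃ V', V' = rxMatrix (-b) * rzMatrix (-a) := ⟨_, rfl⟩
  have hVu : V ∈ Matrix.unitaryGroup (Fin 2) ℂ := by
    rw [hV]; exact mul_mem (rzMatrix_mem_unitary _) (rxMatrix_mem_unitary _)
  have hVu' : V' ∈ Matrix.unitaryGroup (Fin 2) ℂ := by
    rw [hV']; exact mul_mem (rxMatrix_mem_unitary _) (rzMatrix_mem_unitary _)
  have hinv : V' * V = 1 := by
    rw [hV, hV', Matrix.mul_assoc, ← Matrix.mul_assoc (rzMatrix (-a)), rzMatrix_neg_mul,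
      Matrix.one_mul, rxMatrix_neg_mul]
  have hinv' : V * V' = 1 := mul_eq_one_comm.1 hinv
  rw [← hV] at h0 h1
  -- `w N` times the first column of `V` is the eigenvector `v`
  have hcol : v = (w * N) • (V *ᵥ Pi.single 0 1) := by
    funext i
    fin_cases i
    · simp only [Fin.zero_eta, Pi.smul_apply, Matrix.mulVec_single_one, Matrix.col_apply,
        smul_eq_mul]
      rw [mul_right_comm, ← h0, div_mul_cancel₀ _ hNc]
    · simp only [Fin.mk_one, Pi.smul_apply, Matrix.mulVec_single_one, Matrix.col_apply,
        smul_eq_mul]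
      rw [mul_right_comm, ← h1, div_mul_cancel₀ _ hNc]
  have hD : (V' * U * V) 1 0 = 0 := by
    have : (V' * U * V) *ᵥ Pi.single 0 1 = μ • Pi.single 0 1 := by
      have hs : V *ᵥ Pi.single 0 1 = (w * N)⁻¹ • v := by
        rw [hcol, smul_smul, inv_mul_cancel₀ (mul_ne_zero hw hNc), one_smul]
      rw [← Matrix.mulVec_mulVec, hs, Matrix.mulVec_smul, ← Matrix.mulVec_mulVec, hUv,
        Matrix.mulVec_smul, smul_comm, ← Matrix.mulVec_smul, ← hs, Matrix.mulVec_mulVec, hinv,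
        Matrix.one_mulVec]
    have := congrFun this 1
    simpa [Matrix.mulVec_single_one] using this
  obtain ⟨α, β, hαβ⟩ := unitary_eq_diagonal (mul_mem (mul_mem hVu' hU) hVu) hD
  refine ⟨a, b, α, β, ?_⟩
  rw [← hαβ, ← hV, ← hV']
  calc U = (V * V') * U * (V * V') := by rw [hinv', Matrix.one_mul, Matrix.mul_one]
    _ = _ := by simp only [Matrix.mul_assoc]

/-! ### Moving a qubit and collecting the controls -/

section Collect

variable {k : ℕ} {e : ℕ → Fin k}

/-- The position to which the value at position `i` moves when the value at position `P` is moved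
to position `Q`. -/
def shiftedPosition (P Q i : ℕ) : ℕ :=
  if P < i ∧ i ≤ Q then i - 1 else if Q ≤ i ∧ i < P then i + 1 else i

theorem IsPath.exists_move {w : ℕ → Fin k} {r : ℕ} (hw : IsPath w r) :
    ∃ (c : QCircuit k) (F : QBasis k → QBasis k), MapsBasis (QCircuit.op c) F ∧
      QCircuit.IsLNN c ∧ QCircuit.IsParallel c ∧
      (∀ κ, QCircuit.cost c κ = if κ = .cnot then 2 * r else 0) ∧
      (∀ κ, QCircuit.depth c κ ≤ r + 2) ∧
      (∀ y, F y (w r) = y (w 0)) ∧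
      (∀ y, ∀ i < r, F y (w i) = y (w 0) + y (w (i + 1))) ∧
      ∀ y q, (∀ i ≤ r, q ≠ w i) → F y q = y q := by
  refine ⟨transport w r, _, hw.mapsBasis_transport, hw.isLNN_transport, hw.isParallel_transport,
    hw.cost_transport, depth_transport, fun y => ?_, fun y i hi => ?_,
    fun y q hq => actList_transport_of_ne q hq y⟩
  · rw [hw.actList_transport le_rfl, if_pos rfl]
  · rw [hw.actList_transport hi.le, if_neg hi.ne]

/-- The value at position `P` can be moved to position `Q`. The values that it passes move by one
position if it is `0`, and are changed otherwise. -/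
theorem IsLine.exists_move (he : IsLine e) {P Q : ℕ} (hP : P < k) (hQ : Q < k) :
    ∃ (c : QCircuit k) (F : QBasis k → QBasis k), MapsBasis (QCircuit.op c) F ∧
      QCircuit.IsLNN c ∧ QCircuit.IsParallel c ∧
      (∀ κ, QCircuit.cost c κ = if κ = .cnot then 2 * (P - Q + (Q - P)) else 0) ∧
      (∀ κ, QCircuit.depth c κ ≤ P - Q + (Q - P) + 2) ∧
      (∀ y, F y (e Q) = y (e P)) ∧
      (∀ y, y (e P) = 0 → ∀ i < k, i ≠ P → F y (e (shiftedPosition P Q i)) = y (e i)) ∧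
      ∀ y, ∀ i < k, (i < P ∧ i < Q ∨ P < i ∧ Q < i) → F y (e i) = y (e i) := by
  obtain ⟨pos, r, hr, h0, hQ', hpos, hinj, hadj, hw⟩ : ∃ (pos : ℕ → ℕ) (r : ℕ),
      r = P - Q + (Q - P) ∧ pos 0 = P ∧ pos r = Q ∧
      (∀ i, (∃ j ≤ r, i = pos j) ↔ P ≤ i ∧ i ≤ Q ∨ Q ≤ i ∧ i ≤ P) ∧
      (∀ i ≤ r, ∀ j ≤ r, pos i = pos j → i = j) ∧
      (∀ i < r, pos i + 1 = pos (i + 1) ∨ pos (i + 1) + 1 = pos i) ∧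
      ∀ i < r, shiftedPosition P Q (pos (i + 1)) = pos i := by
    rcases le_total P Q with h | h
    · refine ⟨fun i => P + i, Q - P, ?_⟩
      beta_reduce
      refine ⟨by omega, by omega, by omega, fun i =>
        ⟨fun ⟨j, hj, hi⟩ => by omega, fun hi => ⟨i - P, by omega, by omega⟩⟩,
        fun _ _ _ _ _ => by omega, fun _ _ => by omega, fun i hi => ?_⟩
      rw [shiftedPosition, if_pos (by omega)]
      omega
    · refine ⟨fun i => P - i, P - Q, ?_⟩
      beta_reduce
      refine ⟨by omega, by omega, by omega, fun i =>
        ⟨fun ⟨j, hj, hi⟩ => by omega, fun hi => ⟨P - i, by omega, by omega⟩⟩,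
        fun _ _ _ _ _ => by omega, fun _ _ => by omega, fun i hi => ?_⟩
      rw [shiftedPosition, if_neg (by omega), if_pos (by omega)]
      omega
  have hk : ∀ i ≤ r, pos i < k := fun i hi => by
    have := (hpos (pos i)).1 ⟨i, hi, rfl⟩
    omega
  have hpath : IsPath (fun i => e (pos i)) r := by
    refine ⟨fun i hi j hj h => hinj i hi j hj (he.inj _ (hk i hi) _ (hk j hj) h), fun i hi => ?_⟩
    have h1 := hk i hi.le
    have h2 := hk (i + 1) hi
    rcases hadj i hi with h | h
    · have := he.adj (pos i) (by omega)
      rwa [h] at this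
    · have := he.adj (pos (i + 1)) (by omega)
      rw [h] at this
      exact this.symm
  obtain ⟨c, F, hF, hl, hp, hcost, hdepth, hend, hpass, hoff⟩ := hpath.exists_move
  have hoff' : ∀ y, ∀ i < k, ¬ (P ≤ i ∧ i ≤ Q ∨ Q ≤ i ∧ i ≤ P) → F y (e i) = y (e i) := by
    intro y i hi h
    refine hoff y _ fun j hj hij => h ((hpos i).1 ⟨j, hj, he.inj _ hi _ (hk j hj) hij⟩)
  refine ⟨c, F, hF, hl, hp, hr ▸ hcost, hr ▸ hdepth, fun y => ?_, fun y hy i hi hiP => ?_,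
    fun y i hi h => hoff' y i hi (by omega)⟩
  · have := hend y
    rwa [hQ', h0] at this
  · by_cases h : P ≤ i ∧ i ≤ Q ∨ Q ≤ i ∧ i ≤ P
    · obtain ⟨j, hj, rfl⟩ := (hpos i).2 h
      obtain ⟨j, rfl⟩ : ∃ j', j = j' + 1 := ⟨j - 1, by
        have : j ≠ 0 := by rintro rfl; exact hiP h0
        omega⟩
      have := hpass y j hj
      rw [h0, hy, zero_add] at this
      rw [hw j hj, this]
    · rw [shiftedPosition, if_neg (by omega), if_neg (by omega)]
      exact hoff' y i hi h

/-- The arithmetic of the positions: the ancilla moves from `pa` to a position `s` next to the first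
control, which gets the position `s + 1`, and then the target moves to the position `g` next to
these two. Here `m` and `X` are the positions of the first and last control, and `E` is the last
position of a control after the first move. -/
theorem exists_positions {k m X pa pt : ℕ} (hpa : pa < k) (hpt : pt < k) (hta : pt ≠ pa)
    (hX : X < k) (hmX : m ≤ X) (hma : m ≠ pa) (hmt : m ≠ pt) (hXa : X ≠ pa) (hXt : X ≠ pt) :
    ∃ s E g : ℕ, s < k ∧ E < k ∧ g < k ∧
      shiftedPosition pa s m = s + 1 ∧ s + 1 ≤ E ∧ shiftedPosition pa s pt < k ∧
      (s + 1 < shiftedPosition pa s pt ∧ g = s + 2 ∨ shiftedPosition pa s pt < s ∧ g + 1 = s) ∧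
      (∀ i, m ≤ i ∧ i ≤ X ∧ i ≠ pa ∧ i ≠ pt → s < shiftedPosition pa s i ∧
        shiftedPosition pa s i ≤ E ∧ shiftedPosition pa s i ≠ shiftedPosition pa s pt) ∧
      (∀ i j, i ≠ pa → j ≠ pa → i < j → shiftedPosition pa s i < shiftedPosition pa s j) ∧
      ∃ d d', d = pa - s + (s - pa) ∧
        d' = shiftedPosition pa s pt - g + (g - shiftedPosition pa s pt) ∧
        (pa < m → s + 1 = m ∧ pa + d = s) ∧ (m < pa → s = m ∧ s + d = pa) ∧
        (pa < X → E = X) ∧ (X < pa → E = X + 1) ∧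
        (pt < m → pt + d' + 1 ≤ m) ∧ (m < pt → m + d' + 1 ≤ pt) := by
  have hτ : ∀ s i, (pa < i ∧ i ≤ s ∧ shiftedPosition pa s i + 1 = i) ∨
      (s ≤ i ∧ i < pa ∧ shiftedPosition pa s i = i + 1) ∨
      ((i ≤ pa ∨ s < i) ∧ (i < s ∨ pa ≤ i) ∧ shiftedPosition pa s i = i) := by
    intro s i
    rw [shiftedPosition]
    split_ifs <;> omega
  have hmono : ∀ s i j, i ≠ pa → j ≠ pa → i < j →
      shiftedPosition pa s i < shiftedPosition pa s j := by
    intro s i j h1 h2 h3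
    have := hτ s i
    have := hτ s j
    omega
  have hinj : ∀ s i, i ≠ pa → i ≠ pt → shiftedPosition pa s i ≠ shiftedPosition pa s pt := by
    intro s i h1 h2
    rcases lt_or_gt_of_ne h2 with h | h
    · exact (hmono s i pt h1 hta h).ne
    · exact (hmono s pt i hta h1 h).ne'
  rcases lt_or_gt_of_ne hma with h1 | h1
  · obtain ⟨E, hE⟩ : ∃ E, E < k ∧ (pa < X ∧ E = X ∨ X < pa ∧ E = X + 1) := by
      rcases lt_or_gt_of_ne hXa with h | h
      · exact ⟨X + 1, by omega⟩
      · exact ⟨X, by omega⟩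
    have hm := hτ m m
    have ht := hτ m pt
    rcases lt_or_gt_of_ne hmt with h2 | h2
    · refine ⟨m, E, m + 2, by omega, by omega, by omega, by omega, by omega, by omega, by omega,
        fun i hi => ⟨?_, ?_, hinj m i hi.2.2.1 hi.2.2.2⟩, hmono m, _, _, rfl, rfl, ?_⟩
      · have := hτ m i
        omega
      · have := hτ m i
        omega
      · omega
    · refine ⟨m, E, m - 1, by omega, by omega, by omega, by omega, by omega, by omega, by omega,
        fun i hi => ⟨?_, ?_, hinj m i hi.2.2.1 hi.2.2.2⟩, hmono m, _, _, rfl, rfl, ?_⟩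
      · have := hτ m i
        omega
      · have := hτ m i
        omega
      · omega
  · have hm := hτ (m - 1) m
    have ht := hτ (m - 1) pt
    rcases lt_or_gt_of_ne hmt with h2 | h2
    · refine ⟨m - 1, X, m + 1, by omega, by omega, by omega, by omega, by omega, by omega,
        by omega, fun i hi => ⟨?_, ?_, hinj _ i hi.2.2.1 hi.2.2.2⟩, hmono _, _, _, rfl, rfl, ?_⟩
      · have := hτ (m - 1) i
        omega
      · have := hτ (m - 1) i
        omega
      · omega
    · refine ⟨m - 1, X, m - 2, by omega, by omega, by omega, by omega, by omega, by omega,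
        by omega, fun i hi => ⟨?_, ?_, hinj _ i hi.2.2.1 hi.2.2.2⟩, hmono _, _, _, rfl, rfl, ?_⟩
      · have := hτ (m - 1) i
        omega
      · have := hτ (m - 1) i
        omega
      · omega

/-- A circuit that computes on two adjacent qubits whether all controls are `1`, and moves the
target next to them. Here `m` and `X` are the positions of the first and last control, and `s` and
`E` those of the first and last qubit of the chain; `d` and `d'` are the distances by which the
ancilla and the target are moved. -/
theorem IsLine.exists_collect (he : IsLine e) {C : Finset (Fin k)} {n m X pa pt : ℕ}
    (hn : 2 ≤ n) (hC : C.card = n) (hpa : pa < k) (hpt : pt < k) (ha : e pa ∉ C) (ht : e pt ∉ C)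
    (hta : pt ≠ pa) (hm : m < k) (hmC : e m ∈ C) (hmin : ∀ i < k, e i ∈ C → m ≤ i)
    (hX : X < k) (hXC : e X ∈ C) (hmax : ∀ i < k, e i ∈ C → i ≤ X) :
    ∃ s E d d' : ℕ, (pa < m → s + 1 = m ∧ pa + d = s) ∧ (m < pa → s = m ∧ s + d = pa) ∧
      (pa < X → E = X) ∧ (X < pa → E = X + 1) ∧
      (pt < m → pt + d' + 1 ≤ m) ∧ (m < pt → m + d' + 1 ≤ pt) ∧
      ∃ (c : QCircuit k) (F : QBasis k → QBasis k) (q₀ q₁ q₂ : Fin k) (u v κ : Fin 2),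
        MapsBasis (QCircuit.op c) F ∧ QCircuit.IsLNN c ∧ QCircuit.IsParallel c ∧
        (QGate.cnot q₀ q₁).IsLNN ∧ (QGate.cnot q₁ q₂).IsLNN ∧ q₀ ≠ q₂ ∧
        (∀ y, y (e pa) = 0 → ((F y q₀ = u ∧ F y q₁ = v) ↔ ∀ x ∈ C, y x = 1)) ∧
        (∀ y, y (e pa) = 0 → (∀ x ∈ C, y x = 1) → F y q₂ = y (e pt) + κ) ∧
        QCircuit.cost c .rot = 0 ∧
        QCircuit.cost c .cnot + 4 * s + 5 ≤ 4 * E + n + 2 * (d + d') ∧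
        QCircuit.depth c .cnot + 4 * s + 1 ≤ 4 * E + n + (d + d') ∧
        QCircuit.cost c .tgate = 4 * (n - 1) ∧ QCircuit.depth c .tgate ≤ 2 * (n - 1) ∧
        QCircuit.cost c .hadamard = 2 * (n - 1) := by
  have hCpos : ∀ i < k, e i ∈ C → i ≠ pa ∧ i ≠ pt := fun i hi h =>
    ⟨by rintro rfl; exact ha h, by rintro rfl; exact ht h⟩
  have hm' := hCpos m hm hmC
  have hX' := hCpos X hX hXC
  have hmX := hmin X hX hXC
  obtain ⟨s, E, g, hsk, hEk, hgk, hq, hsE, ht'k, hcase, hpos, hmono, d, d', hd, hd', hfacts⟩ :=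
    exists_positions hpa hpt hta hX hmX hm'.1 hm'.2 hX'.1 hX'.2
  obtain ⟨τ, hτ⟩ : ∃ τ : ℕ → ℕ, τ = shiftedPosition pa s := ⟨_, rfl⟩
  rw [← hτ] at hq ht'k hcase hpos hmono hd'
  obtain ⟨t', ht'⟩ : ∃ t', t' = τ pt := ⟨_, rfl⟩
  rw [← ht'] at ht'k hcase hpos hd'
  obtain ⟨A, FA, hFA, hAl, hAp, hAcost, hAdepth, hAs, hAτ, -⟩ := he.exists_move hpa hsk
  obtain ⟨B, FB, hFB, hBl, hBp, hBcost, hBdepth, hBg, -, hBoff⟩ := he.exists_move ht'k hgk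
  -- the positions of the controls in increasing order
  obtain ⟨S, hS⟩ : ∃ S : Finset ℕ, S = (Finset.range k).filter fun i => e i ∈ C := ⟨_, rfl⟩
  have hSmem : ∀ i, i ∈ S ↔ i < k ∧ e i ∈ C := fun i => by simp [hS]
  have hScard : S.card = n := by
    rw [← hC]
    refine Finset.card_bij (fun i _ => e i) (fun i hi => ((hSmem i).1 hi).2)
      (fun i hi j hj h => he.inj i ((hSmem i).1 hi).1 j ((hSmem j).1 hj).1 h) fun q hq => ?_
    obtain ⟨i, hi, rfl⟩ := he.surj q
    exact ⟨i, (hSmem i).2 ⟨hi, hq⟩, rfl⟩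
  obtain ⟨L, hLmem, hLsort, hLlen⟩ : ∃ L : List ℕ, (∀ i, i ∈ L ↔ i < k ∧ e i ∈ C) ∧
      L.Pairwise (· < ·) ∧ L.length = n :=
    ⟨S.sort, fun i => by rw [Finset.mem_sort, hSmem], (Finset.sortedLT_sort S).pairwise,
      by rw [Finset.length_sort, hScard]⟩
  obtain ⟨tl, rfl⟩ : ∃ tl, L = m :: tl := by
    cases L with
    | nil => simp at hLlen; omega
    | cons p tl =>
      have h1 := (hLmem p).1 (by simp)
      have h2 := hmin p h1.1 h1.2
      rcases List.mem_cons.1 ((hLmem m).2 ⟨hm, hmC⟩) with h3 | h3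
      · exact ⟨tl, by rw [h3]⟩
      · have := (List.pairwise_cons.1 hLsort).1 m h3
        omega
  have hlen : (tl.map τ).length = n - 1 := by
    rw [List.length_map]; simp at hLlen; omega
  have hLfacts : ∀ i ∈ m :: tl, m ≤ i ∧ i ≤ X ∧ i ≠ pa ∧ i ≠ pt := fun i hi => by
    have h := (hLmem i).1 hi
    exact ⟨hmin i h.1 h.2, hmax i h.1 h.2, hCpos i h.1 h.2⟩
  have hsort : (s :: τ m :: tl.map τ).Pairwise (· < ·) := by
    rw [← List.map_cons, List.pairwise_cons]
    refine ⟨fun x hx => ?_, ?_⟩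
    · obtain ⟨i, hi, rfl⟩ := List.mem_map.1 hx
      exact (hpos i (hLfacts i hi)).1
    · rw [List.pairwise_map]
      exact hLsort.imp_of_mem fun {i j} hi hj hij =>
        hmono i j (hLfacts i hi).2.2.1 (hLfacts j hj).2.2.1 hij
  have hle : ∀ x ∈ s :: τ m :: tl.map τ, x ≤ E := by
    rw [← List.map_cons]
    intro x hx
    rcases List.mem_cons.1 hx with rfl | hx
    · omega
    · obtain ⟨i, hi, rfl⟩ := List.mem_map.1 hx
      exact (hpos i (hLfacts i hi)).2.1
  obtain ⟨G, hG, -, hGflag, κ, hGκ⟩ := he.mapsBasis_chain s (τ m) (tl.map τ) hsort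
    fun x hx => (hle x hx).trans_lt hEk
  obtain ⟨hGl, hGp, hGrot, hGcnot, hGt, hGh, hGtd⟩ := he.cost_chain E hEk s (τ m) (tl.map τ)
    hsort hle
  have ht'notMem : t' ∉ s :: τ m :: tl.map τ := by
    rw [← List.map_cons]
    intro hx
    rcases List.mem_cons.1 hx with hx | hx
    · omega
    · obtain ⟨i, hi, hit⟩ := List.mem_map.1 hx
      exact (hpos i (hLfacts i hi)).2.2 hit
  have hflagA : ∀ y, y (e pa) = 0 →
      ((∀ x ∈ τ m :: tl.map τ, FA y (e x) = 1) ↔ ∀ x ∈ C, y x = 1) := by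
    intro y hy
    rw [← List.map_cons, List.forall_mem_map]
    have h : ∀ i ∈ m :: tl, FA y (e (τ i)) = y (e i) := fun i hi => by
      have := hLfacts i hi
      rw [hτ]
      exact hAτ y hy i (this.2.1.trans_lt hX) this.2.2.1
    constructor
    · intro h1 x hx
      obtain ⟨i, hi, rfl⟩ := he.surj x
      have hi' := (hLmem i).2 ⟨hi, hx⟩
      rw [← h i hi']
      exact h1 i hi'
    · intro h1 i hi
      rw [h i hi]
      exact h1 _ ((hLmem i).1 hi).2
  have hne : ∀ i < k, ∀ j < k, i ≠ j → e i ≠ e j := fun i hi j hj h h' => h (he.inj i hi j hj h')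
  have hqk : s + 1 < k := hsE.trans_lt hEk
  have hqk' : τ m < k := hq ▸ hqk
  have hs' : s < t' ∧ s < g ∨ t' < s ∧ g < s := by omega
  have hq' : τ m < t' ∧ τ m < g ∨ t' < τ m ∧ g < τ m := by omega
  have hFs : ∀ y, FB (G (FA y)) (e s) = G (FA y) (e s) := fun y => hBoff _ s hsk hs'
  have hFq : ∀ y, FB (G (FA y)) (e (τ m)) = G (FA y) (e (τ m)) := fun y =>
    hBoff _ (τ m) hqk' hq'
  have hadj := he.adj s hqk
  have hAcnot := hAcost .cnot
  have hBcnot := hBcost .cnot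
  rw [if_pos rfl] at hAcnot hBcnot
  have hGdepth := QCircuit.depth_le_cost (chain e (s :: τ m :: tl.map τ)) .cnot
  have hAd := hAdepth .cnot
  have hBd := hBdepth .cnot
  have hAt := QCircuit.depth_le_cost A .tgate
  have hBt := QCircuit.depth_le_cost B .tgate
  have hzero : ∀ κ, κ ≠ GateKind.cnot → QCircuit.cost A κ = 0 ∧ QCircuit.cost B κ = 0 := by
    intro κ h
    rw [hAcost, hBcost, if_neg h, if_neg h]
    exact ⟨rfl, rfl⟩
  have hzt := hzero .tgate (by decide)
  have hzr := hzero .rot (by decide)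
  have hzh := hzero .hadamard (by decide)
  rw [hlen] at hGcnot hGt hGh hGtd hGflag
  have hflag : ∀ y, y (e pa) = 0 →
      ((FB (G (FA y)) (e s) = chainFlip (n - 1 + 1) ∧
        FB (G (FA y)) (e (τ m)) = chainValue (n - 1 + 1)) ↔ ∀ x ∈ C, y x = 1) := by
    intro y hy
    rw [hFs, hFq, ← hflagA y hy, ← hGflag, hAs, hy, zero_add]
  have htarget : ∀ y, y (e pa) = 0 → (∀ x ∈ C, y x = 1) →
      FB (G (FA y)) (e g) = y (e pt) + κ t' := by
    intro y hy hy1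
    rw [hBg, hGκ _ ((hflagA y hy).2 hy1) t' ht'k ht'notMem, ht', hτ, hAτ y hy pt hpt hta]
  have hmaps : MapsBasis (QCircuit.op (A ++ (chain e (s :: τ m :: tl.map τ) ++ B)))
      fun y => FB (G (FA y)) := by
    rw [QCircuit.op_append, QCircuit.op_append]
    exact hFA.mul (hG.mul hFB)
  obtain ⟨hf1, hf2, hf3, hf4, hf5, hf6⟩ := hfacts
  refine ⟨s, E, d, d', hf1, hf2, hf3, hf4, hf5, hf6, A ++ (chain e (s :: τ m :: tl.map τ) ++ B),
    fun y => FB (G (FA y)), ?_⟩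
  have hlnn := QCircuit.isLNN_append hAl (QCircuit.isLNN_append hGl hBl)
  have hpar := QCircuit.isParallel_append hAp (QCircuit.isParallel_append hGp hBp)
  simp only [QCircuit.cost_append, QCircuit.depth_append]
  have hcost : QCircuit.cost A .rot + (QCircuit.cost (chain e (s :: τ m :: tl.map τ)) .rot +
      QCircuit.cost B .rot) = 0 ∧
      QCircuit.cost A .cnot + (QCircuit.cost (chain e (s :: τ m :: tl.map τ)) .cnot +
        QCircuit.cost B .cnot) + 4 * s + 5 ≤
        4 * E + n + 2 * (d + d') ∧
      QCircuit.depth A .cnot + (QCircuit.depth (chain e (s :: τ m :: tl.map τ)) .cnot +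
        QCircuit.depth B .cnot) + 4 * s + 1 ≤
        4 * E + n + (d + d') ∧
      QCircuit.cost A .tgate + (QCircuit.cost (chain e (s :: τ m :: tl.map τ)) .tgate +
        QCircuit.cost B .tgate) = 4 * (n - 1) ∧
      QCircuit.depth A .tgate + (QCircuit.depth (chain e (s :: τ m :: tl.map τ)) .tgate +
        QCircuit.depth B .tgate) ≤ 2 * (n - 1) ∧
      QCircuit.cost A .hadamard + (QCircuit.cost (chain e (s :: τ m :: tl.map τ)) .hadamard +
        QCircuit.cost B .hadamard) = 2 * (n - 1) := by
    clear hf1 hf2 hf3 hf4 hf5 hf6 hm' hX' hcase hs' hq'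
    rw [← hd] at hAcnot hAd
    rw [← hd'] at hBcnot hBd
    rw [hq] at *
    omega
  rw [hq] at hflag hmaps hlnn hpar hcost hqk' ⊢
  rcases hcase with ⟨h, rfl⟩ | ⟨h, rfl⟩
  · exact ⟨e s, e (s + 1), e (s + 2), _, _, _, hmaps, hlnn, hpar, hadj, he.adj (s + 1) hgk,
      hne s hsk _ hgk (by omega), hflag, htarget, hcost⟩
  · exact ⟨e (g + 1 + 1), e (g + 1), e g, _, _, _, hmaps, hlnn, hpar, hadj.symm,
      (he.adj g hsk).symm, hne _ hqk g hgk (by omega),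
      fun y hy => by rw [and_comm]; exact hflag y hy, htarget, hcost⟩

end Collect

/-! ### The multi-controlled gate -/

section Synthesis

variable {k : ℕ}

/-- Gates on another qubit `t` before and after an operator do not disturb a clean ancilla `a`. -/
theorem implements_conj {N W : QOp k} {t a : Fin k} (hta : t ≠ a)
    (h : ImplementsWithCleanAncilla N W a)
    (V V' : Matrix (Fin 2) (Fin 2) ℂ) :
    ImplementsWithCleanAncilla (controlledOp ∅ t V * N * controlledOp ∅ t V')
      (controlledOp ∅ t V * W * controlledOp ∅ t V') a := by
  obtain ⟨z, hz, h⟩ := h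
  refine ⟨z, hz, fun y hy x => ?_⟩
  rw [Matrix.mul_assoc, Matrix.mul_assoc, Matrix.mul_apply, Matrix.mul_apply, Finset.mul_sum]
  refine Finset.sum_congr rfl fun w _ => ?_
  rw [Matrix.mul_apply, Matrix.mul_apply, Finset.mul_sum, Finset.mul_sum, Finset.mul_sum]
  refine Finset.sum_congr rfl fun v _ => ?_
  by_cases hv : v a = 0
  · rw [h v hv w]
    ring
  · have : controlledOp ∅ t V' v y = 0 := by
      simp only [controlledOp, Matrix.of_apply]
      rw [if_neg fun h' => hv (by rw [h' a hta.symm, hy])]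
    rw [this]
    ring

/-- A circuit `c` that collects the controls on two qubits `q₀` and `q₁` and the target on `q₂`
gives the multi-controlled gate: conjugated by `c`, a diagonal operator on these three qubits is the
controlled diagonal gate. -/
theorem exists_circuit_of_mapsBasis {C : Finset (Fin k)} {t a : Fin k} (ht : t ∉ C) (hta : t ≠ a)
    {U : Matrix (Fin 2) (Fin 2) ℂ} (hU : U ∈ Matrix.unitaryGroup (Fin 2) ℂ)
    {c : QCircuit k} {F : QBasis k → QBasis k} {q₀ q₁ q₂ : Fin k} {u v κ : Fin 2}
    (hF : MapsBasis (QCircuit.op c) F) (hl : QCircuit.IsLNN c) (hp : QCircuit.IsParallel c)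
    (h01 : (QGate.cnot q₀ q₁).IsLNN) (h12 : (QGate.cnot q₁ q₂).IsLNN) (h02 : q₀ ≠ q₂)
    (hflag : ∀ y, y a = 0 → ((F y q₀ = u ∧ F y q₁ = v) ↔ ∀ x ∈ C, y x = 1))
    (htarget : ∀ y, y a = 0 → (∀ x ∈ C, y x = 1) → F y q₂ = y t + κ) :
    ∃ c' : QCircuit k, QCircuit.IsParallel c' ∧ QCircuit.IsLNN c' ∧
      ImplementsWithCleanAncilla (QCircuit.op c') (controlledOp C t U) a ∧
      QCircuit.cost c' .rot = 2 * QCircuit.cost c .rot + 11 ∧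
      QCircuit.cost c' .cnot = 2 * QCircuit.cost c .cnot + 8 ∧
      QCircuit.depth c' .cnot ≤ 2 * QCircuit.depth c .cnot + 8 ∧
      QCircuit.cost c' .tgate = 2 * QCircuit.cost c .tgate ∧
      QCircuit.depth c' .tgate ≤ 2 * QCircuit.depth c .tgate ∧
      QCircuit.cost c' .hadamard = 2 * QCircuit.cost c .hadamard := by
  obtain ⟨ω, η, α, β, hUeq⟩ := exists_rotation_diagonalization hU
  obtain ⟨Δ, hΔ⟩ : ∃ Δ : Matrix (Fin 2) (Fin 2) ℂ,
      Δ = !![Complex.exp (Complex.I * α), 0; 0, Complex.exp (Complex.I * β)] := ⟨_, rfl⟩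
  rw [← hΔ] at hUeq
  obtain ⟨θ, z, hz, hD⟩ := exists_diagonalGates q₀ q₁ q₂ h01 h12 h02
    fun b₀ b₁ b₂ => if b₀ = u ∧ b₁ = v then if b₂ = κ then α else β else 0
  obtain ⟨pre, hpre⟩ : ∃ pre : QCircuit k,
      pre = QCircuit.serial [.rz (-ω) t, .rx (-η) t] := ⟨_, rfl⟩
  obtain ⟨post, hpost⟩ : ∃ post : QCircuit k,
      post = QCircuit.serial [.rx η t, .rz ω t] := ⟨_, rfl⟩
  obtain ⟨diag, hdiag⟩ : ∃ diag : QCircuit k,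
      diag = QCircuit.serial (diagonalGates q₀ q₁ q₂ θ) := ⟨_, rfl⟩
  have hpre_op : QCircuit.op pre = controlledOp ∅ t (rxMatrix (-η) * rzMatrix (-ω)) := by
    rw [hpre, QCircuit.op, QCircuit.flatten_serial, ← controlledOp_mul (Finset.notMem_empty t)]
    simp only [QCircuit.opOfGates, Matrix.one_mul, QGate.op]
  have hpost_op : QCircuit.op post = controlledOp ∅ t (rzMatrix ω * rxMatrix η) := by
    rw [hpost, QCircuit.op, QCircuit.flatten_serial, ← controlledOp_mul (Finset.notMem_empty t)]
    simp only [QCircuit.opOfGates, Matrix.one_mul, QGate.op]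
  have hdiag_op : QCircuit.op diag = QCircuit.opOfGates (diagonalGates q₀ q₁ q₂ θ) := by
    rw [hdiag, QCircuit.op, QCircuit.flatten_serial]
  have hinv : QCircuit.op (QCircuit.inv c) * QCircuit.op c = 1 := by
    rw [QCircuit.op, QCircuit.op, QCircuit.flatten_inv]
    refine QCircuit.opOfGates_inv_mul _ fun g hg => ?_
    obtain ⟨L, hL, hg⟩ := List.mem_flatten.1 hg
    exact hl L hL g hg
  have hcΔ := controlledOp_diagonal_apply C t Δ (fun i j hij => by
    rw [hΔ]; fin_cases i <;> fin_cases j <;> simp_all)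
  have hmid : ImplementsWithCleanAncilla
      (QCircuit.op (QCircuit.inv c) * QCircuit.op diag * QCircuit.op c)
      (controlledOp C t Δ) a := by
    refine ⟨z, hz, fun y hy x => ?_⟩
    rw [conj_diagonal_apply hF hinv (fun x y => by rw [hdiag_op]; exact hD x y), hcΔ]
    by_cases hxy : x = y
    · rw [if_pos hxy, if_pos hxy]
      congr 1
      by_cases hy1 : ∀ x ∈ C, y x = 1
      · rw [if_pos hy1, if_pos ((hflag y hy).2 hy1), htarget y hy hy1, hΔ]
        generalize y t = b
        fin_cases b <;> simp
      · rw [if_neg hy1, if_neg fun h => hy1 ((hflag y hy).1 h)]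
        simp
    · rw [if_neg hxy, if_neg hxy, mul_zero]
  have hVV : rzMatrix ω * rxMatrix η * (rxMatrix (-η) * rzMatrix (-ω)) = 1 := by
    have h1 := mul_eq_one_comm.1 (rxMatrix_neg_mul η)
    have h2 := mul_eq_one_comm.1 (rzMatrix_neg_mul ω)
    rw [Matrix.mul_assoc, ← Matrix.mul_assoc (rxMatrix η), h1, Matrix.one_mul, h2]
  have hcount : ∀ κ', QCircuit.cost pre κ' = (if κ' = .rot then 2 else 0) ∧
      QCircuit.cost post κ' = (if κ' = .rot then 2 else 0) ∧
      QCircuit.cost diag κ' = if κ' = .rot then 7 else if κ' = .cnot then 8 else 0 := by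
    intro κ'
    rw [hpre, hpost, hdiag, QCircuit.cost_serial, QCircuit.cost_serial, QCircuit.cost_serial]
    cases κ' <;> exact ⟨rfl, rfl, rfl⟩
  have hr := hcount .rot
  have hc := hcount .cnot
  have hT := hcount .tgate
  have hH := hcount .hadamard
  simp only [reduceCtorEq, if_true, if_false] at hr hc hT hH
  refine ⟨pre ++ (c ++ (diag ++ (QCircuit.inv c ++ post))), ?_, ?_, ?_, ?_⟩
  · refine QCircuit.isParallel_append (hpre ▸ QCircuit.isParallel_serial _)
      (QCircuit.isParallel_append hp (QCircuit.isParallel_append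
        (hdiag ▸ QCircuit.isParallel_serial _) (QCircuit.isParallel_append
          (QCircuit.isParallel_inv hp) (hpost ▸ QCircuit.isParallel_serial _))))
  · refine QCircuit.isLNN_append (hpre ▸ QCircuit.isLNN_serial ?_)
      (QCircuit.isLNN_append hl (QCircuit.isLNN_append
        (hdiag ▸ QCircuit.isLNN_serial (isLNN_diagonalGates h01 h12 θ)) (QCircuit.isLNN_append
          (QCircuit.isLNN_inv hl) (hpost ▸ QCircuit.isLNN_serial ?_)))) <;>
      simp [QGate.IsLNN]
  · have := implements_conj hta hmid (rzMatrix ω * rxMatrix η) (rxMatrix (-η) * rzMatrix (-ω))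
    rw [controlledOp_conj ht _ _ _ hVV, ← hUeq, ← hpre_op, ← hpost_op] at this
    simpa only [QCircuit.op_append, Matrix.mul_assoc] using this
  · have hd1 := QCircuit.depth_le_cost pre .cnot
    have hd2 := QCircuit.depth_le_cost post .cnot
    have hd3 := QCircuit.depth_le_cost diag .cnot
    have hd4 := QCircuit.depth_le_cost pre .tgate
    have hd5 := QCircuit.depth_le_cost post .tgate
    have hd6 := QCircuit.depth_le_cost diag .tgate
    simp only [QCircuit.cost_append, QCircuit.depth_append, QCircuit.cost_inv, QCircuit.depth_inv]
    omega

end Synthesis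

/-- The line read forwards. Only the positions below `k` matter. -/
theorem isLine_val (k : ℕ) (hk : 0 < k) :
    IsLine fun i => if h : i < k then (⟨i, h⟩ : Fin k) else ⟨0, hk⟩ := by
  refine ⟨fun i hi j hj h => ?_, fun q => ⟨q.val, q.isLt, ?_⟩, fun i hi => ?_⟩
  · simpa [hi, hj] using h
  · simp
  · left
    simp [hi, show i < k by omega]

/-- The line read backwards. -/
theorem isLine_rev (k : ℕ) (hk : 0 < k) :
    IsLine fun i => (⟨k - 1 - i, by omega⟩ : Fin k) := by
  refine ⟨fun i hi j hj h => ?_, fun q => ⟨k - 1 - q.val, by omega, ?_⟩, fun i hi => ?_⟩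
  · have := congrArg Fin.val h
    simp only at this
    omega
  · ext
    simp only
    omega
  · right
    simp only
    omega

/-- In one of the two directions of the line, the ancilla and the target are close enough to
the places to which they are moved. Here `d` and `d'` are their distances, and `s` and `E` are the
ends of the chain; `r`, `r'`, `s'` and `E'` are the same data for the line read backwards, on which
the first control is at `k - 1 - X` and the last one at `k - 1 - m`. -/
theorem exists_short_direction {k m X a t s E d d' s' E' r r' : ℕ} (hm : m < k) (hX : X < k)
    (ha : a < k) (ht : t < k) (hmX : m ≤ X) (hma : m ≠ a) (hmt : m ≠ t) (hXa : X ≠ a)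
    (hXt : X ≠ t) (hs : a < m → s + 1 = m ∧ a + d = s) (hs₁ : m < a → s = m ∧ s + d = a)
    (hE : a < X → E = X) (hE₁ : X < a → E = X + 1)
    (hd : t < m → t + d' + 1 ≤ m) (hd₁ : m < t → m + d' + 1 ≤ t)
    (hs' : k - 1 - a < k - 1 - X → s' + 1 = k - 1 - X ∧ k - 1 - a + r = s')
    (hs₁' : k - 1 - X < k - 1 - a → s' = k - 1 - X ∧ s' + r = k - 1 - a)
    (hE' : k - 1 - a < k - 1 - m → E' = k - 1 - m)
    (hE₁' : k - 1 - m < k - 1 - a → E' = k - 1 - m + 1)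
    (hd' : k - 1 - t < k - 1 - X → k - 1 - t + r' + 1 ≤ k - 1 - X)
    (hd₁' : k - 1 - X < k - 1 - t → k - 1 - X + r' + 1 ≤ k - 1 - t) :
    (8 * E + 4 * (d + d') ≤ 8 * s + 12 * k + 6 ∧ 8 * E + 2 * (d + d') ≤ 8 * s + 10 * k + 6) ∨
      (8 * E' + 4 * (r + r') ≤ 8 * s' + 12 * k + 6 ∧
        8 * E' + 2 * (r + r') ≤ 8 * s' + 10 * k + 6) := by
  rcases lt_or_gt_of_ne hma with h1 | h1 <;> rcases lt_or_gt_of_ne hXa with h2 | h2 <;>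
    rcases lt_or_gt_of_ne hmt with h3 | h3 <;> rcases lt_or_gt_of_ne hXt with h4 | h4 <;>
    omega

theorem mainTheorem6 (n k : ℕ) (hn : 6 ≤ n) (hk : n + 1 < k)
    (C : Finset (Fin k)) (hC : C.card = n) (t a : Fin k)
    (ht : t ∉ C) (ha : a ∉ C) (hta : t ≠ a)
    (U : Matrix (Fin 2) (Fin 2) ℂ) (hU : U ∈ Matrix.unitaryGroup (Fin 2) ℂ) :
    ∃ c : QCircuit k,
      QCircuit.IsParallel c ∧ QCircuit.IsLNN c ∧
      ImplementsWithCleanAncilla (QCircuit.op c) (controlledOp C t U) a ∧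
      QCircuit.cost c .rot = 11 ∧
      QCircuit.cost c .cnot ≤ 12 * k + 12 * n - 56 ∧
      QCircuit.depth c .cnot ≤ 10 * k + 4 * n ∧
      QCircuit.cost c .tgate ≤ 16 * n - 32 ∧
      QCircuit.depth c .tgate ≤ 4 * n ∧
      QCircuit.cost c .hadamard ≤ 8 * n - 8 ∧
      QCircuit.depth c .hadamard ≤ 4 * n - 1 := by
  have hk0 : 0 < k := by omega
  have hne : C.Nonempty := Finset.card_pos.1 (by omega)
  obtain ⟨m, hm⟩ : ∃ m, m = C.min' hne := ⟨_, rfl⟩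
  obtain ⟨X, hX⟩ : ∃ X, X = C.max' hne := ⟨_, rfl⟩
  have hmC : m ∈ C := hm ▸ C.min'_mem hne
  have hXC : X ∈ C := hX ▸ C.max'_mem hne
  have hmin : ∀ q ∈ C, m.val ≤ q.val := fun q hq => hm ▸ C.min'_le q hq
  have hmax : ∀ q ∈ C, q.val ≤ X.val := fun q hq => hX ▸ C.le_max' q hq
  have hdist : ∀ q ∈ C, q.val ≠ t.val ∧ q.val ≠ a.val := fun q hq =>
    ⟨fun h => ht (Fin.ext h ▸ hq), fun h => ha (Fin.ext h ▸ hq)⟩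
  have hta' : t.val ≠ a.val := fun h => hta (Fin.ext h)
  have hval : ∀ q : Fin k, (if h : q.val < k then (⟨q.val, h⟩ : Fin k) else ⟨0, hk0⟩) = q :=
    fun q => by simp
  have hrev : ∀ q : Fin k, (⟨k - 1 - (k - 1 - q.val), by omega⟩ : Fin k) = q := fun q => by
    ext
    simp only
    omega
  -- the first control and the last one exchange their roles when the line is read backwards
  obtain ⟨s₁, E₁, d₁, d₁', f1, f2, f3, f4, f5, f6, c₁, F₁, q₁, r₁, p₁, u₁, v₁, κ₁, hF₁, hl₁, hp₁,
    h01, h12, h02, hfl₁, htg₁, hrot₁, hcn₁, hcd₁, htc₁, htd₁, hhc₁⟩ :=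
    (isLine_val k hk0).exists_collect (C := C) (n := n) (m := m.val) (X := X.val) (pa := a.val)
      (pt := t.val) (by omega) hC a.isLt t.isLt (by rwa [hval]) (by rwa [hval]) hta' m.isLt
      (by rwa [hval]) (fun i hi h => by simpa [hi] using hmin _ h) X.isLt (by rwa [hval])
      (fun i hi h => by simpa [hi] using hmax _ h)
  obtain ⟨s₂, E₂, d₂, d₂', g1, g2, g3, g4, g5, g6, c₂, F₂, q₂, r₂, p₂, u₂, v₂, κ₂, hF₂, hl₂, hp₂,
    i01, i12, i02, hfl₂, htg₂, hrot₂, hcn₂, hcd₂, htc₂, htd₂, hhc₂⟩ :=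
    (isLine_rev k hk0).exists_collect (C := C) (n := n) (m := k - 1 - X.val) (X := k - 1 - m.val)
      (pa := k - 1 - a.val) (pt := k - 1 - t.val) (by omega) hC (by omega) (by omega)
      (by rwa [hrev]) (by rwa [hrev]) (by omega) (by omega) (by rwa [hrev])
      (fun i hi h => by have := hmax _ h; simp only at this; omega) (by omega) (by rwa [hrev])
      (fun i hi h => by have := hmin _ h; simp only at this; omega)
  simp only [hval] at hfl₁ htg₁
  simp only [hrev] at hfl₂ htg₂
  obtain ⟨b₁, hb₁⟩ := exists_circuit_of_mapsBasis ht hta hU hF₁ hl₁ hp₁ h01 h12 h02 hfl₁ htg₁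
  obtain ⟨b₂, hb₂⟩ := exists_circuit_of_mapsBasis ht hta hU hF₂ hl₂ hp₂ i01 i12 i02 hfl₂ htg₂
  have hH₁ := QCircuit.depth_le_cost b₁ .hadamard
  have hH₂ := QCircuit.depth_le_cost b₂ .hadamard
  obtain ⟨hbp₁, hbl₁, hbi₁, hbc₁⟩ := hb₁
  obtain ⟨hbp₂, hbl₂, hbi₂, hbc₂⟩ := hb₂
  have hm' := hdist m hmC
  have hX' := hdist X hXC
  rcases exists_short_direction m.isLt X.isLt a.isLt t.isLt (hmin X hXC) hm'.2 hm'.1 hX'.2 hX'.1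
    f1 f2 f3 f4 f5 f6 g1 g2 g3 g4 g5 g6 with hle | hle
  · clear f1 f2 f3 f4 f5 f6 g1 g2 g3 g4 g5 g6
    exact ⟨b₁, hbp₁, hbl₁, hbi₁, by omega⟩
  · clear f1 f2 f3 f4 f5 f6 g1 g2 g3 g4 g5 g6
    exact ⟨b₂, hbp₂, hbl₂, hbi₂, by omega⟩
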